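/- Let $\sigma$ be the surface measure on $\mathbb{S}^2\subset\mathbb{R}^3$ (so $\sigma(\mathbb{S}^2)=4\pi$), let $d(s,t)=\arccos(s\cdot t)$ be the geodesic distance, and let $P_\ell(x)=\frac{1}{2^\ell \ell!}\frac{d^\ell}{dx^\ell}(x^2-1)^\ell$ be the Legendre polynomials. Quadrature. For each $j\in\mathbb{N}_0$ let $n_j\geq 1$, weights $\lambda_{jk}>0$ and nodes $\xi_{jk}\in\mathbb{S}^2$, $k=1,\dots,n_j$, be given such that (a) $\int_{\mathbb{S}^2} f\,d\sigma=\sum_{k=1}^{n_j}\lambda_{jk} f(\xi_{jk})$ for every polynomial $f$ of degree at most $2(2^j-1)$; (b) $n_j\leq C_0 2^{2j}$ with $C_0>0$ independent of $j$; (c) with $h_j=\sup_{s\in\mathbb{S}^2}\min_{1\leq k\leq n_j} d(s,\xi_{jk})$, one has $\frac{h_j}{4}\leq h_{j+1}\leq\frac{h_j}{2}$ for all $j$; (d) $h_j\leq d(\xi_{jk},\xi_{jk'})$ for all $j$ and all $k\neq k'$; (e) $\lambda_{jk}\leq c\,2^{-2j}$ with $c>0$ independent of $j,k$. Cutoff.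 Let $r>2$ be an integer and $\kappa\in C^r(\mathbb{R})$ a real-valued function with $\operatorname{supp}\kappa=[\frac12,2]$ and $|\kappa(t)|^2+|\kappa(2t)|^2=1$ for $t\in[\frac12,1]$. Put $b_j(t)=\kappa(2^{-j}(2t+1))$. Power spectrum. Let $\mathsf{A}=(A_\ell)_{\ell\in\mathbb{N}_0}$ be a sequence of nonnegative real numbers with $\sum_{\ell}(2\ell+1)A_\ell<\infty$. Let $\Delta^0_\ell=\sqrt{A_\ell}$ and $\Delta^i_\ell=\Delta^{i-1}_{\ell+1}-\Delta^{i-1}_\ell$ for $i \geq 1$, and suppose that for some $\beta>0$ and $c_r>0$, $$|\Delta^r_\ell|\leq c_r(1+\ell)^{-(1+\beta+r)}\qquad\text{for all }\ell\in\mathbb{N}_0 .$$ Define the modified needlets $$\psi^{\mathsf{A}}_{jk}(s)=\sqrt{\lambda_{jk}}\,\sum_{\ell=0}^\infty b_j(\ell)\sqrt{A_\ell}\,\frac{2\ell+1}{4\pi}P_\ell(s\cdot\xi_{jk}),\qquad s\in\mathbb{S}^2 .$$ Then there exists $C>0$, independent of $j$, such that for every $j\in\mathbb{N}_0$, $$\sup_{s\in\mathbb{S}^2}\sum_{k=1}^{n_j}|\psi^{\mathsf{A}}_{jk}(s)|\leq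 C\,2^{-\beta j}.$$ -/

import Mathlib

namespace Needlet

/-- The unit sphere in three-dimensional Euclidean space. -/
abbrev S2 : Type := Metric.sphere (0 : EuclideanSpace ℝ (Fin 3)) 1

/-- The surface measure on the unit sphere, of total mass `4π`. -/
noncomputable def surfaceMeasure : MeasureTheory.Measure S2 :=
  (MeasureTheory.volume : MeasureTheory.Measure (EuclideanSpace ℝ (Fin 3))).toSphere

/-- The Euclidean inner product of two points of the sphere. -/
noncomputable def dot (s t : S2) : ℝ :=
  inner ℝ (s : EuclideanSpace ℝ (Fin 3)) (t : EuclideanSpace ℝ (Fin 3))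

/-- The geodesic distance on the sphere. -/
noncomputable def geodesicDist (s t : S2) : ℝ := Real.arccos (dot s t)

/-- The Legendre polynomial of degree `ℓ`, by Rodrigues' formula
`P_ℓ(x) = 1 / (2^ℓ ℓ!) * (d/dx)^ℓ (x^2 - 1)^ℓ`. -/
noncomputable def legendre (ℓ : ℕ) : Polynomial ℝ :=
  Polynomial.C (1 / (2 ^ ℓ * (Nat.factorial ℓ : ℝ))) *
    Polynomial.derivative^[ℓ] ((Polynomial.X ^ 2 - 1) ^ ℓ)

/-- Weights and nodes on the sphere, with `n j` of them at each level `j`. -/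
structure QuadratureFamily where
  n : ℕ → ℕ
  weight : (j : ℕ) → Fin (n j) → ℝ
  node : (j : ℕ) → Fin (n j) → S2

/-- The mesh norm `h_j`: the largest distance of a point of the sphere to the nodes of level `j`. -/
noncomputable def QuadratureFamily.meshNorm (Q : QuadratureFamily) (j : ℕ) : ℝ :=
  ⨆ s : S2, ⨅ k : Fin (Q.n j), geodesicDist s (Q.node j k)

/-- The standing assumptions on the family of quadratures. -/
structure QuadratureFamily.IsAdmissible (Q : QuadratureFamily) : Prop where
  n_pos : ∀ j, 0 < Q.n j
  weight_pos : ∀ j k, 0 < Q.weight j k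
  exact : ∀ (j : ℕ) (p : MvPolynomial (Fin 3) ℝ), p.totalDegree ≤ 2 * (2 ^ j - 1) →
    ∫ s : S2, MvPolynomial.eval (fun i => (s : EuclideanSpace ℝ (Fin 3)) i) p ∂surfaceMeasure =
      ∑ k : Fin (Q.n j), Q.weight j k *
        MvPolynomial.eval (fun i => (Q.node j k : EuclideanSpace ℝ (Fin 3)) i) p
  card_le : ∃ C : ℝ, 0 < C ∧ ∀ j, (Q.n j : ℝ) ≤ C * 2 ^ (2 * j)
  mesh_lower : ∀ j, Q.meshNorm j / 4 ≤ Q.meshNorm (j + 1)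
  mesh_upper : ∀ j, Q.meshNorm (j + 1) ≤ Q.meshNorm j / 2
  mesh_ratio : ∀ j (k k' : Fin (Q.n j)), k ≠ k' →
    Q.meshNorm j ≤ geodesicDist (Q.node j k) (Q.node j k')
  weight_le : ∃ c : ℝ, 0 < c ∧ ∀ j k, Q.weight j k ≤ c * ((2 : ℝ) ^ (2 * j))⁻¹

/-- The standing assumptions on the cutoff function `κ` of smoothness `r`. -/
structure IsCutoff (r : ℕ) (κ : ℝ → ℝ) : Prop where
  two_lt : 2 < r
  contDiff : ContDiff ℝ r κ
  tsupport_eq : tsupport κ = Set.Icc (1 / 2) 2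
  partition : ∀ t ∈ Set.Icc (1 / 2 : ℝ) 1, |κ t| ^ 2 + |κ (2 * t)| ^ 2 = 1

/-- `b_j(t) = κ(2^{-j} (2 t + 1))`. -/
noncomputable def levelCutoff (κ : ℝ → ℝ) (j : ℕ) (t : ℝ) : ℝ :=
  κ (((2 : ℝ) ^ j)⁻¹ * (2 * t + 1))

/-- The kernel `K_j^A(x) = ∑_ℓ b_j(ℓ) √A_ℓ (2ℓ+1)/(4π) P_ℓ(x)`. For a cutoff function `κ` only finitely
many terms are nonzero. -/
noncomputable def modifiedKernel (κ : ℝ → ℝ) (A : ℕ → ℝ) (j : ℕ) (x : ℝ) : ℝ :=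
  ∑' ℓ : ℕ, levelCutoff κ j ℓ * √(A ℓ) * ((2 * (ℓ : ℝ) + 1) / (4 * Real.pi)) * (legendre ℓ).eval x

/-- The modified needlet `ψ^A_{jk}(s) = √λ_{jk} K_j^A(s ⬝ ξ_{jk})`. -/
noncomputable def modifiedNeedlet (κ : ℝ → ℝ) (A : ℕ → ℝ) (Q : QuadratureFamily) (j : ℕ)
    (k : Fin (Q.n j)) (s : S2) : ℝ :=
  √(Q.weight j k) * modifiedKernel κ A j (dot s (Q.node j k))

end Needlet

/-! Write q = 2^j and let ρ be the Euclidean distance from s to a node, so that 1 - x = ρ²/2 for x =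
s·ξ. The kernel is localised: |K_j(x)| is at most a constant times q^(-(1+β)) (q² (1 + qρ)⁻³ + 1)
(`IsScaled.abs_sum_legendre_le`). The nodes are separated at scale 1/q, so the terms (1 + qρ)⁻³ have
a bounded sum over them (`exists_sum_node_le`), and the summand 1 contributes n_j = O(q²). With √λ =
O(1/q) the total is q⁻¹ · q^(-(1+β)) · q² = q^(-β).

Localisation is summation by parts in ℓ. Multiplying a Legendre series by 1 - x turns its
coefficients into essentially second differences (`one_sub_mul_sum_legendre`). One more Abel
summation, against P'_{ℓ+1} + P'_ℓ, produces third differences; the derivatives obey √(1-x²)|P'_ℓ| ≤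
ℓ+1. Three differences thus buy the power ρ⁻³, enough for summability in two dimensions.

The coefficients b_j(ℓ)√A_ℓ gain q⁻¹ per difference (`exists_isScaled`): b_j by smoothness of κ, and
√A because the bound on its order-r differences descends to lower orders by summing tails. The
separation of nodes comes from counting: O(q²) nodes cannot have mesh norm much below 1/q
(`exists_le_meshNorm`). -/

namespace Needlet

/-! ### Legendre polynomials: recurrences, differential equation, uniform bounds. -/

section Legendre

open Polynomial

theorem C_two : (C (2 : ℝ) : ℝ[X]) = 2 := map_ofNat C 2

theorem iterate_derivative_succ_X_mul (n : ℕ) (p : ℝ[X]) :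
    derivative^[n + 1] (X * p) = X * derivative^[n + 1] p + ((n : ℝ[X]) + 1) * derivative^[n] p := by
  induction n with
  | zero => simp; ring
  | succ n ih =>
    rw [Function.iterate_succ_apply', ih, Function.iterate_succ_apply' _ (n + 1) p,
      Function.iterate_succ_apply' _ n p]
    simp only [derivative_add, derivative_mul, derivative_X, derivative_natCast, derivative_one]
    push_cast
    ring

theorem two_pow_mul_factorial_mul_legendre (n : ℕ) :
    C (2 ^ n * (n.factorial : ℝ)) * legendre n = derivative^[n] ((X ^ 2 - 1) ^ n) := by
  have h : (2 ^ n * (n.factorial : ℝ)) ≠ 0 := by positivity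
  rw [legendre, ← mul_assoc, ← C_mul, mul_one_div_cancel h, C_1, one_mul]

theorem C_two_pow_succ_mul_factorial (n : ℕ) :
    (C (2 ^ (n + 1) * ((n + 1).factorial : ℝ)) : ℝ[X]) =
      2 * ((n : ℝ[X]) + 1) * C (2 ^ n * (n.factorial : ℝ)) := by
  have : (2 * ((n : ℝ[X]) + 1)) = C (2 * ((n : ℝ) + 1)) := by simp [C_two]
  rw [this, ← C_mul, Nat.factorial_succ]
  push_cast
  ring_nf

theorem C_two_pow_mul_factorial_ne_zero (n : ℕ) :
    (C (2 ^ n * (n.factorial : ℝ)) : ℝ[X]) ≠ 0 := by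
  rw [Ne, C_eq_zero]; positivity

theorem two_mul_natCast_add_one_ne_zero (n : ℕ) : (2 * ((n : ℝ[X]) + 1)) ≠ 0 := by
  have : (2 * ((n : ℝ[X]) + 1)) = C (2 * ((n : ℝ) + 1)) := by simp [C_two]
  rw [this, Ne, C_eq_zero]; positivity

theorem legendre_zero : legendre 0 = 1 := by simp [legendre]

theorem derivative_X_sq_sub_one_pow_succ (n : ℕ) :
    derivative ((X ^ 2 - 1 : ℝ[X]) ^ (n + 1)) =
      (2 * ((n : ℝ[X]) + 1)) * (X * (X ^ 2 - 1) ^ n) := by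
  rw [derivative_pow_succ]
  simp
  ring

theorem iterate_derivative_two_mul_natCast_add_one_mul (k n : ℕ) (p : ℝ[X]) :
    derivative^[k] (2 * ((n : ℝ[X]) + 1) * p) = 2 * ((n : ℝ[X]) + 1) * derivative^[k] p := by
  have : (2 * ((n : ℝ[X]) + 1)) = C (2 * ((n : ℝ) + 1)) := by simp [C_two]
  rw [this, iterate_derivative_C_mul]

theorem derivative_legendre_succ (n : ℕ) :
    derivative (legendre (n + 1)) = X * derivative (legendre n) + ((n : ℝ[X]) + 1) * legendre n := by
  have h0 := C_two_pow_mul_factorial_ne_zero n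
  have h1 := two_mul_natCast_add_one_ne_zero n
  apply mul_left_cancel₀ (mul_ne_zero h1 h0)
  have e1 := congrArg derivative (two_pow_mul_factorial_mul_legendre (n + 1))
  rw [derivative_C_mul, ← Function.iterate_succ_apply' derivative,
    Function.iterate_succ_apply, derivative_X_sq_sub_one_pow_succ,
    iterate_derivative_two_mul_natCast_add_one_mul, iterate_derivative_succ_X_mul,
    Function.iterate_succ_apply', ← two_pow_mul_factorial_mul_legendre, derivative_C_mul,
    C_two_pow_succ_mul_factorial] at e1
  rw [e1]
  ring

/-- Two of the n + 3 derivatives in Rodrigues' formula are applied to (X²-1)^(n+2). Writing X² =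
(X²-1) + 1 leaves a combination of (X²-1)^(n+1) and (X²-1)^n, whose remaining n + 1 derivatives are
multiples of P_{n+1} and P'_n. -/
theorem derivative_legendre_add_two (n : ℕ) :
    derivative (legendre (n + 2)) =
      derivative (legendre n) + (2 * (n : ℝ[X]) + 3) * legendre (n + 1) := by
  have h0 := C_two_pow_mul_factorial_ne_zero n
  have h1 := two_mul_natCast_add_one_ne_zero n
  have h2 := two_mul_natCast_add_one_ne_zero (n + 1)
  apply mul_left_cancel₀ (mul_ne_zero h2 (mul_ne_zero h1 h0))
  have key : derivative (derivative ((X ^ 2 - 1 : ℝ[X]) ^ (n + 2))) =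
      C (2 * ((n : ℝ) + 1 + 1)) * (C (2 * (n : ℝ) + 3) * (X ^ 2 - 1) ^ (n + 1) +
        C (2 * ((n : ℝ) + 1)) * (X ^ 2 - 1) ^ n) := by
    have e : (2 * (((n + 1 : ℕ) : ℝ[X]) + 1)) = C (2 * ((n : ℝ) + 1 + 1)) := by simp [C_two]
    rw [derivative_X_sq_sub_one_pow_succ (n + 1), e, derivative_C_mul, derivative_mul,
      derivative_X_sq_sub_one_pow_succ n]
    simp only [derivative_X, map_mul, map_add, C_1, map_natCast, map_ofNat]
    ring
  have e1 := congrArg derivative (two_pow_mul_factorial_mul_legendre (n + 2))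
  have e2 := two_pow_mul_factorial_mul_legendre (n + 1)
  have e3 := congrArg derivative (two_pow_mul_factorial_mul_legendre n)
  rw [derivative_C_mul, ← Function.iterate_succ_apply' derivative] at e3
  rw [derivative_C_mul, ← Function.iterate_succ_apply' derivative,
    Function.iterate_succ_apply, Function.iterate_succ_apply, key, iterate_derivative_C_mul,
    iterate_map_add, iterate_derivative_C_mul, iterate_derivative_C_mul, ← e2, ← e3,
    C_two_pow_succ_mul_factorial (n + 1), C_two_pow_succ_mul_factorial n] at e1
  simp only [map_mul, map_add, C_1, map_natCast, map_ofNat] at e1 ⊢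
  push_cast at e1 ⊢
  linear_combination e1

theorem legendre_one : legendre 1 = X := by
  have h := two_pow_mul_factorial_mul_legendre 1
  have h2 : (C 2 : ℝ[X]) ≠ 0 := by simp only [Ne, C_eq_zero]; norm_num
  apply mul_left_cancel₀ h2
  simp only [pow_one, Nat.factorial_one, Nat.cast_one, mul_one, C_two, Function.iterate_one,
    derivative_sub, derivative_X_pow, derivative_one] at h
  rw [C_two, h]
  simp [C_two]

/-- `P'_{n+1} + P'_n` telescopes `∑ (2 ℓ + 1) P_ℓ`. -/
theorem two_mul_add_one_mul_legendre (n : ℕ) :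
    (2 * (n : ℝ[X]) + 1) * legendre n =
      (derivative (legendre (n + 1)) + derivative (legendre n)) -
        (derivative (legendre n) + derivative (legendre (n - 1))) := by
  cases n with
  -- The truncated index 0 - 1 = 0 is harmless, since P'_0 = 0.
  | zero => simp [legendre_zero, legendre_one]
  | succ n =>
    rw [derivative_legendre_add_two]
    push_cast
    ring

theorem X_mul_derivative_legendre_succ (n : ℕ) :
    X * derivative (legendre (n + 1)) =
      derivative (legendre n) + ((n : ℝ[X]) + 1) * legendre (n + 1) := by
  have h1 := derivative_legendre_add_two n
  have h2 := derivative_legendre_succ (n + 1)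
  push_cast at h2
  linear_combination h1 - h2

theorem X_sq_sub_one_mul_derivative_legendre (n : ℕ) :
    (X ^ 2 - 1) * derivative (legendre n) =
      ((n : ℝ[X]) + 1) * (legendre (n + 1) - X * legendre n) := by
  have h1 := derivative_legendre_succ n
  have h2 := X_mul_derivative_legendre_succ n
  linear_combination h2 - X * h1

theorem legendre_ode (n : ℕ) :
    (X ^ 2 - 1) * derivative (derivative (legendre n)) + 2 * X * derivative (legendre n) =
      (n : ℝ[X]) * ((n : ℝ[X]) + 1) * legendre n := by
  have h := congrArg derivative (X_sq_sub_one_mul_derivative_legendre n)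
  have h1 := derivative_legendre_succ n
  simp only [derivative_mul, derivative_sub, derivative_add, derivative_X, derivative_natCast,
    derivative_one, derivative_X_pow, h1] at h
  simp [C_two] at h
  linear_combination h

theorem legendre_three_term (n : ℕ) :
    (2 * (n : ℝ[X]) + 1) * X * legendre n =
      ((n : ℝ[X]) + 1) * legendre (n + 1) + (n : ℝ[X]) * legendre (n - 1) := by
  cases n with
  | zero => simp [legendre_zero, legendre_one]
  | succ n =>
    have h1 := X_sq_sub_one_mul_derivative_legendre (n + 1)
    have h2 := derivative_legendre_succ n
    have h3 := X_mul_derivative_legendre_succ n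
    push_cast at *
    linear_combination h1 + h2 - X * h3

theorem eval_one_legendre (n : ℕ) : (legendre n).eval 1 = 1 := by
  induction n with
  | zero => simp [legendre_zero]
  | succ n ih =>
    have h := congrArg (eval 1) (X_sq_sub_one_mul_derivative_legendre n)
    simp only [eval_mul, eval_sub, eval_add, eval_X, eval_pow, eval_one, eval_natCast, ih] at h
    have hn : (n : ℝ) + 1 ≠ 0 := by positivity
    have : (n + 1 : ℝ) * (eval 1 (legendre (n + 1)) - 1 * 1) = 0 := by rw [← h]; ring
    rcases mul_eq_zero.1 this with h' | h'
    · exact absurd h' hn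
    · linarith

/-- The sign (-1)^n is not needed: only the square enters the energy at the endpoint. -/
theorem eval_neg_one_legendre_sq (n : ℕ) : (legendre n).eval (-1) ^ 2 = 1 := by
  induction n with
  | zero => simp [legendre_zero]
  | succ n ih =>
    have h := congrArg (eval (-1)) (X_sq_sub_one_mul_derivative_legendre n)
    simp only [eval_mul, eval_sub, eval_add, eval_X, eval_pow, eval_one, eval_natCast] at h
    have hn : (n : ℝ) + 1 ≠ 0 := by positivity
    have : (n + 1 : ℝ) * (eval (-1) (legendre (n + 1)) - -1 * eval (-1) (legendre n)) = 0 := by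
      rw [← h]; ring
    rcases mul_eq_zero.1 this with h' | h'
    · exact absurd h' hn
    · have : eval (-1) (legendre (n + 1)) = - eval (-1) (legendre n) := by linarith
      rw [this, neg_sq, ih]

/-- The energy of the Legendre equation. -/
noncomputable def legendreEnergy (n : ℕ) : ℝ[X] :=
  (n : ℝ[X]) * ((n : ℝ[X]) + 1) * legendre n ^ 2 + (1 - X ^ 2) * derivative (legendre n) ^ 2

theorem derivative_legendreEnergy (n : ℕ) :
    derivative (legendreEnergy n) = 2 * X * derivative (legendre n) ^ 2 := by
  have h := legendre_ode n
  simp only [legendreEnergy, derivative_mul, derivative_sub, derivative_add, derivative_X,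
    derivative_natCast, derivative_one, derivative_pow]
  simp [C_two]
  linear_combination (-2) * derivative (legendre n) * h

/-- Sonin's argument: the derivative 2x P'² has the sign of x, so on [-1, 1] the energy is largest
at an endpoint, where it equals n(n+1). Dropping either of its two nonnegative terms gives |P_n| ≤ 1
and the Bernstein bound on P'_n. -/
theorem legendreEnergy_eval_le (n : ℕ) {x : ℝ} (hx : x ∈ Set.Icc (-1 : ℝ) 1) :
    (legendreEnergy n).eval x ≤ n * (n + 1) := by
  have hd (y : ℝ) : deriv (fun y => (legendreEnergy n).eval y) y =
      2 * y * (derivative (legendre n)).eval y ^ 2 := by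
    rw [Polynomial.deriv, derivative_legendreEnergy]; simp
  rcases le_total 0 x with h0 | h0
  · have hm : MonotoneOn (fun y => (legendreEnergy n).eval y) (Set.Icc 0 1) := by
      apply monotoneOn_of_deriv_nonneg (convex_Icc _ _) (by fun_prop) (by fun_prop)
      intro y hy
      rw [interior_Icc] at hy
      rw [hd]
      have := hy.1
      positivity
    have := hm ⟨h0, hx.2⟩ (Set.right_mem_Icc.2 zero_le_one) hx.2
    refine this.trans (le_of_eq ?_)
    simp [legendreEnergy, eval_one_legendre]
  · have hm : AntitoneOn (fun y => (legendreEnergy n).eval y) (Set.Icc (-1) 0) := by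
      apply antitoneOn_of_deriv_nonpos (convex_Icc _ _) (by fun_prop) (by fun_prop)
      intro y hy
      rw [interior_Icc] at hy
      rw [hd]
      exact mul_nonpos_of_nonpos_of_nonneg (by linarith [hy.2]) (sq_nonneg _)
    have := hm (Set.left_mem_Icc.2 (by norm_num)) ⟨hx.1, h0⟩ hx.1
    refine this.trans (le_of_eq ?_)
    simp [legendreEnergy, eval_neg_one_legendre_sq]

theorem abs_eval_legendre_le_one (n : ℕ) {x : ℝ} (hx : x ∈ Set.Icc (-1 : ℝ) 1) :
    |(legendre n).eval x| ≤ 1 := by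
  rcases Nat.eq_zero_or_pos n with rfl | hn
  · simp [legendre_zero]
  · have h := legendreEnergy_eval_le n hx
    simp only [legendreEnergy, eval_mul, eval_sub, eval_add, eval_X, eval_pow, eval_one,
      eval_natCast] at h
    have h1 : 0 ≤ (1 - x ^ 2) * (derivative (legendre n)).eval x ^ 2 :=
      mul_nonneg (by nlinarith [hx.1, hx.2]) (sq_nonneg _)
    have hn' : (0 : ℝ) < n * (n + 1) := by positivity
    rw [← sq_le_one_iff_abs_le_one]
    nlinarith

theorem sqrt_mul_abs_eval_derivative_legendre_le (n : ℕ) {x : ℝ} (hx : x ∈ Set.Icc (-1 : ℝ) 1) :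
    √(1 - x ^ 2) * |(derivative (legendre n)).eval x| ≤ n + 1 := by
  have h := legendreEnergy_eval_le n hx
  simp only [legendreEnergy, eval_mul, eval_sub, eval_add, eval_X, eval_pow, eval_one,
    eval_natCast] at h
  have h1 : 0 ≤ (n : ℝ) * (n + 1) * (legendre n).eval x ^ 2 := by positivity
  have h2 : 0 ≤ 1 - x ^ 2 := by nlinarith [hx.1, hx.2]
  have hn : (0 : ℝ) ≤ n := by positivity
  refine abs_le_of_sq_le_sq' ?_ (by positivity) |>.2
  rw [mul_pow, Real.sq_sqrt h2, sq_abs]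
  nlinarith

end Legendre

/-! ### Summation by parts for Legendre series. -/

section SummationByParts

open Polynomial Finset

/-- The operator on coefficients that corresponds to multiplying `∑ (2 ℓ + 1) a_ℓ P_ℓ(x)`
by `1 - x`. -/
noncomputable def legendreShift (a : ℕ → ℝ) (l : ℕ) : ℝ :=
  (((l : ℝ) + 1) * (a l - a (l + 1)) - l * (a (l - 1) - a l)) / (2 * l + 1)

theorem one_sub_mul_sum_legendre (a : ℕ → ℝ) (x : ℝ) (M : ℕ) (ha : ∀ l, M ≤ l → a l = 0) :
    (1 - x) * ∑ l ∈ range (M + 1), (2 * (l : ℝ) + 1) * a l * (legendre l).eval x =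
      ∑ l ∈ range (M + 1), (2 * (l : ℝ) + 1) * legendreShift a l * (legendre l).eval x := by
  have key : ∀ N : ℕ,
      (1 - x) * ∑ l ∈ range N, (2 * (l : ℝ) + 1) * a l * (legendre l).eval x =
      ∑ l ∈ range N, (2 * (l : ℝ) + 1) * legendreShift a l * (legendre l).eval x +
        N * (a N * (legendre (N - 1)).eval x - a (N - 1) * (legendre N).eval x) := by
    intro N
    induction N with
    | zero => simp
    | succ N ih =>
      rw [sum_range_succ, sum_range_succ, mul_add, ih]
      have h := congrArg (eval x) (legendre_three_term N)
      simp only [eval_mul, eval_add, eval_X, eval_one, eval_natCast, eval_ofNat] at h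
      have hs : (2 * (N : ℝ) + 1) * legendreShift a N =
          (((N : ℝ) + 1) * (a N - a (N + 1)) - N * (a (N - 1) - a N)) := by
        rw [legendreShift, mul_div_cancel₀]; positivity
      rw [hs]
      push_cast
      linear_combination (-a N) * h
  -- The boundary term at N = M + 1 involves both a_{M+1} and a_M, so the sum runs one index beyond
  -- the support.
  rw [key, ha (M + 1) (by omega), Nat.add_sub_cancel, ha M le_rfl]
  ring

theorem sum_legendre_eq_sum_derivative (d : ℕ → ℝ) (x : ℝ) (N : ℕ) (hd : d N = 0) :
    ∑ l ∈ range N, (2 * (l : ℝ) + 1) * d l * (legendre l).eval x =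
      ∑ l ∈ range N, (d l - d (l + 1)) *
        ((derivative (legendre (l + 1))).eval x + (derivative (legendre l)).eval x) := by
  have key : ∀ N : ℕ, ∑ l ∈ range N, (2 * (l : ℝ) + 1) * d l * (legendre l).eval x =
      ∑ l ∈ range N, (d l - d (l + 1)) *
        ((derivative (legendre (l + 1))).eval x + (derivative (legendre l)).eval x) +
      d N * ((derivative (legendre N)).eval x + (derivative (legendre (N - 1))).eval x) := by
    intro N
    induction N with
    | zero => simp [legendre_zero]
    | succ N ih =>
      rw [sum_range_succ, sum_range_succ, ih]
      have h := congrArg (eval x) (two_mul_add_one_mul_legendre N)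
      simp only [eval_mul, eval_add, eval_sub, eval_one, eval_natCast, eval_ofNat] at h
      simp only [Nat.add_sub_cancel]
      linear_combination d N * h
  rw [key, hd, zero_mul, add_zero]

theorem abs_sum_legendre_le (a : ℕ → ℝ) {x B : ℝ} (hx : x ∈ Set.Icc (-1 : ℝ) 1) (N : ℕ)
    (ha : ∀ l, |a l| ≤ B) :
    |∑ l ∈ range N, (2 * (l : ℝ) + 1) * a l * (legendre l).eval x| ≤ 2 * N ^ 2 * B := by
  have hB : 0 ≤ B := (abs_nonneg _).trans (ha 0)
  calc _ ≤ ∑ l ∈ range N, |(2 * (l : ℝ) + 1) * a l * (legendre l).eval x| := abs_sum_le_sum_abs _ _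
    _ ≤ ∑ l ∈ range N, 2 * N * B := by
      apply sum_le_sum
      intro l hl
      have hl' : (l : ℝ) + 1 ≤ N := by exact_mod_cast mem_range.1 hl
      rw [abs_mul, abs_mul, abs_of_nonneg (by positivity : 0 ≤ 2 * (l : ℝ) + 1)]
      calc _ ≤ (2 * N) * B * 1 := by
            gcongr
            · linarith
            · exact ha l
            · exact abs_eval_legendre_le_one l hx
        _ = _ := mul_one _
    _ = _ := by simp; ring

theorem abs_sum_derivative_legendre_le (d : ℕ → ℝ) {x B : ℝ} (hx : x ∈ Set.Icc (-1 : ℝ) 1)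
    (N : ℕ) (hd : ∀ l, |d l - d (l + 1)| ≤ B) :
    √(1 - x ^ 2) * |∑ l ∈ range N, (d l - d (l + 1)) *
        ((derivative (legendre (l + 1))).eval x + (derivative (legendre l)).eval x)| ≤
      3 * N ^ 2 * B := by
  have hB : 0 ≤ B := (abs_nonneg _).trans (hd 0)
  calc _ ≤ √(1 - x ^ 2) * ∑ l ∈ range N, |(d l - d (l + 1)) *
        ((derivative (legendre (l + 1))).eval x + (derivative (legendre l)).eval x)| := by
        gcongr; exact abs_sum_le_sum_abs _ _
    -- The two Bernstein bounds add up to (l+2) + (l+1) ≤ 2N + 1 ≤ 3N.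
    _ ≤ ∑ l ∈ range N, B * (3 * N) := by
      rw [mul_sum]
      apply sum_le_sum
      intro l hl
      have hl' : (l : ℝ) + 1 ≤ N := by exact_mod_cast mem_range.1 hl
      have h1 := sqrt_mul_abs_eval_derivative_legendre_le l hx
      have h2 := sqrt_mul_abs_eval_derivative_legendre_le (l + 1) hx
      push_cast at h2
      rw [abs_mul, mul_left_comm]
      have h3 := abs_add_le ((derivative (legendre (l + 1))).eval x)
        ((derivative (legendre l)).eval x)
      have h4 := mul_le_mul_of_nonneg_left h3 (Real.sqrt_nonneg (1 - x ^ 2))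
      exact mul_le_mul (hd l) (by linarith) (by positivity) hB
    _ = _ := by simp; ring

end SummationByParts

end Needlet

namespace Needlet

/-! ### Separation of the nodes and sums over them. -/

section Geometry

theorem norm_S2 (s : S2) : ‖(s : EuclideanSpace ℝ (Fin 3))‖ = 1 := by
  simp

theorem norm_sub_sq_eq_dot (s t : S2) :
    ‖(s : EuclideanSpace ℝ (Fin 3)) - t‖ ^ 2 = 2 - 2 * dot s t := by
  rw [norm_sub_sq_real, norm_S2, norm_S2, dot]; ring

theorem dot_mem_Icc (s t : S2) : dot s t ∈ Set.Icc (-1 : ℝ) 1 := by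
  have := abs_real_inner_le_norm (s : EuclideanSpace ℝ (Fin 3)) t
  rw [norm_S2, norm_S2, one_mul] at this
  exact abs_le.1 this

theorem cos_geodesicDist (s t : S2) : Real.cos (geodesicDist s t) = dot s t :=
  Real.cos_arccos (dot_mem_Icc s t).1 (dot_mem_Icc s t).2

theorem geodesicDist_nonneg (s t : S2) : 0 ≤ geodesicDist s t := Real.arccos_nonneg _

/-- Chord and arc are comparable by 1 - θ²/2 ≤ cos θ ≤ 1 - 2θ²/π². This lets the hypotheses on
geodesic distances be used in Euclidean form. -/
theorem norm_sub_le_geodesicDist (s t : S2) :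
    ‖(s : EuclideanSpace ℝ (Fin 3)) - t‖ ≤ geodesicDist s t := by
  have h := Real.one_sub_sq_div_two_le_cos (x := geodesicDist s t)
  rw [cos_geodesicDist] at h
  refine abs_le_of_sq_le_sq' ?_ (geodesicDist_nonneg s t) |>.2
  rw [norm_sub_sq_eq_dot]
  linarith

theorem geodesicDist_le_norm_sub (s t : S2) :
    geodesicDist s t ≤ Real.pi / 2 * ‖(s : EuclideanSpace ℝ (Fin 3)) - t‖ := by
  have h := Real.cos_le_one_sub_mul_cos_sq (x := geodesicDist s t)
    (by rw [abs_of_nonneg (geodesicDist_nonneg s t)]; exact Real.arccos_le_pi _)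
  rw [cos_geodesicDist] at h
  refine abs_le_of_sq_le_sq' ?_ (by positivity) |>.2
  rw [mul_pow, norm_sub_sq_eq_dot]
  have hpi := Real.pi_pos
  have : geodesicDist s t ^ 2 =
      Real.pi ^ 2 / 2 * (2 / Real.pi ^ 2 * geodesicDist s t ^ 2) := by field_simp
  rw [this, div_pow]
  nlinarith [mul_le_mul_of_nonneg_left h (by positivity : 0 ≤ Real.pi ^ 2 / 2)]

theorem abs_apply_sub_le (s t : EuclideanSpace ℝ (Fin 3)) (i : Fin 3) :
    |s i - t i| ≤ ‖s - t‖ := by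
  simpa using PiLp.norm_apply_le (s - t) i

theorem exists_geodesicDist_le_meshNorm (Q : QuadratureFamily) (j : ℕ) (hn : 0 < Q.n j) (s : S2) :
    ∃ k, geodesicDist s (Q.node j k) ≤ Q.meshNorm j := by
  have : Nonempty (Fin (Q.n j)) := ⟨⟨0, hn⟩⟩
  obtain ⟨k, hk⟩ := exists_eq_ciInf_of_finite (f := fun k => geodesicDist s (Q.node j k))
  refine ⟨k, ?_⟩
  rw [hk]
  refine le_ciSup (f := fun s : S2 => ⨅ k, geodesicDist s (Q.node j k)) ⟨Real.pi, ?_⟩ s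
  rintro _ ⟨t, rfl⟩
  exact (ciInf_le (Set.finite_range _).bddBelow ⟨0, hn⟩).trans (Real.arccos_le_pi _)

/-- The point of the upper hemisphere above `(x, y)`. -/
theorem exists_S2_apply_eq {x y : ℝ} (h : x ^ 2 + y ^ 2 ≤ 1) :
    ∃ s : S2, (s : EuclideanSpace ℝ (Fin 3)) 0 = x ∧ (s : EuclideanSpace ℝ (Fin 3)) 1 = y := by
  refine ⟨⟨!₂[x, y, √(1 - x ^ 2 - y ^ 2)], ?_⟩, by simp, by simp⟩
  rw [mem_sphere_zero_iff_norm, ← sq_eq_sq₀ (norm_nonneg _) zero_le_one,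
    EuclideanSpace.real_norm_sq_eq, Fin.sum_univ_three]
  simp [Real.sq_sqrt (by linarith : 0 ≤ 1 - x ^ 2 - y ^ 2)]

/-- Few nodes cannot cover the sphere well. -/
theorem sq_le_of_meshNorm_lt (Q : QuadratureFamily) (j N : ℕ) (hn : 0 < Q.n j)
    (hN : 4 * N * Q.meshNorm j < 1) : N ^ 2 ≤ Q.n j := by
  rcases Nat.eq_zero_or_pos N with rfl | hN0
  · simp
  have hN0' : (0 : ℝ) < N := by exact_mod_cast hN0
  have hc : ∀ a : Fin N, 0 ≤ (a : ℝ) / (2 * N) ∧ (a : ℝ) / (2 * N) ≤ 1 / 2 := by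
    intro a
    refine ⟨by positivity, ?_⟩
    rw [div_le_div_iff₀ (by positivity) (by norm_num)]
    have : ((a : ℕ) : ℝ) ≤ N := by exact_mod_cast a.2.le
    linarith
  -- N² test points lie above the planar grid of spacing 1/(2N) in [0, 1/2]², which is inside the
  -- unit disc.
  have hp : ∀ v : Fin N × Fin N, ∃ s : S2,
      (s : EuclideanSpace ℝ (Fin 3)) 0 = (v.1 : ℝ) / (2 * N) ∧
      (s : EuclideanSpace ℝ (Fin 3)) 1 = (v.2 : ℝ) / (2 * N) := by
    intro v
    apply exists_S2_apply_eq
    nlinarith [hc v.1, hc v.2]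
  choose p hp0 hp1 using hp
  choose k hk using fun v => exists_geodesicDist_le_meshNorm Q j hn (p v)
  have hk' : ∀ v, ‖(p v : EuclideanSpace ℝ (Fin 3)) - Q.node j (k v)‖ ≤ Q.meshNorm j :=
    fun v => (norm_sub_le_geodesicDist _ _).trans (hk v)
  have hfin : ∀ a b : Fin N, |(a : ℝ) / (2 * N) - (b : ℝ) / (2 * N)| ≤ 2 * Q.meshNorm j →
      a = b := by
    intro a b hab
    rw [← sub_div, abs_div, abs_of_pos (by positivity : (0 : ℝ) < 2 * N),
      div_le_iff₀ (by positivity)] at hab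
    have h1 : |((a : ℤ) : ℝ) - ((b : ℤ) : ℝ)| < 1 := by
      push_cast
      linarith
    have h2 : |(a : ℤ) - (b : ℤ)| < 1 := by exact_mod_cast h1
    have h3 := Int.abs_lt_one_iff.1 h2
    ext
    omega
  -- Test points that share a node differ by at most 2 h_j in each coordinate, less than the grid
  -- spacing.
  have hinj : Function.Injective k := by
    intro v w hvw
    have hv := hk' v
    have hw := hk' w
    rw [hvw] at hv
    have hi : ∀ i, |(p v : EuclideanSpace ℝ (Fin 3)) i - (p w : EuclideanSpace ℝ (Fin 3)) i| ≤
        2 * Q.meshNorm j := by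
      intro i
      have h1 := (abs_apply_sub_le _ _ i).trans hv
      have h2 := (abs_apply_sub_le _ _ i).trans hw
      rw [abs_le] at h1 h2 ⊢
      constructor <;> linarith [h1.1, h1.2, h2.1, h2.2]
    have h0 := hi 0
    have h1 := hi 1
    rw [hp0, hp0] at h0
    rw [hp1, hp1] at h1
    exact Prod.ext (hfin _ _ h0) (hfin _ _ h1)
  have := Fintype.card_le_of_injective k hinj
  simpa [sq] using this

/-- If h_j were below 1/(4M·2^j), the counting lemma with N = M·2^j would give M²·4^j ≤ n_j ≤ C·4^j,
which is impossible for M > C + 1. -/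
theorem exists_le_meshNorm (Q : QuadratureFamily) (hQ : Q.IsAdmissible) :
    ∃ c : ℝ, 0 < c ∧ ∀ j, c ≤ 2 ^ j * Q.meshNorm j := by
  obtain ⟨C, hC, hn⟩ := hQ.card_le
  obtain ⟨M, hM⟩ := exists_nat_gt (C + 1)
  have hM1 : (1 : ℝ) < M := by linarith
  refine ⟨1 / (4 * M), by positivity, fun j => ?_⟩
  by_contra! hlt
  have h := sq_le_of_meshNorm_lt Q j (M * 2 ^ j) (hQ.n_pos j) (by
    push_cast
    rw [lt_div_iff₀ (by positivity)] at hlt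
    linarith)
  have h' : ((M * 2 ^ j : ℕ) : ℝ) ^ 2 ≤ Q.n j := by exact_mod_cast h
  push_cast at h'
  rw [mul_pow, ← pow_mul, mul_comm j 2] at h'
  have h2 := (mul_le_mul_iff_left₀ (by positivity : (0 : ℝ) < 2 ^ (2 * j))).1 (h'.trans (hn j))
  nlinarith

theorem exists_le_norm_node_sub (Q : QuadratureFamily) (hQ : Q.IsAdmissible) :
    ∃ c : ℝ, 0 < c ∧ ∀ j (k k' : Fin (Q.n j)), k ≠ k' →
      c ≤ 2 ^ j * ‖(Q.node j k : EuclideanSpace ℝ (Fin 3)) - Q.node j k'‖ := by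
  obtain ⟨c, hc, h⟩ := exists_le_meshNorm Q hQ
  have hpi := Real.pi_pos
  refine ⟨c / (Real.pi / 2), by positivity, fun j k k' hk => ?_⟩
  rw [div_le_iff₀ (by positivity)]
  have h1 := (hQ.mesh_ratio j k k' hk).trans (geodesicDist_le_norm_sub _ _)
  have h2 := mul_le_mul_of_nonneg_left h1 (by positivity : (0 : ℝ) ≤ 2 ^ j)
  linarith [h j]

/-- On the part of the sphere where `|z| ≥ 1 / 2`, the projection along the `z`-axis does not
bring points much closer together. -/
theorem sq_dist_lt_of_abs_lt {x y z x' y' z' σ ε : ℝ} (h : x ^ 2 + y ^ 2 + z ^ 2 = 1)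
    (h' : x' ^ 2 + y' ^ 2 + z' ^ 2 = 1) (hσ : |σ| = 1) (hz : 1 / 2 ≤ σ * z) (hz' : 1 / 2 ≤ σ * z')
    (hx : |x - x'| < ε) (hy : |y - y'| < ε) :
    (x - x') ^ 2 + (y - y') ^ 2 + (z - z') ^ 2 < (5 * ε) ^ 2 := by
  have hε : 0 < ε := (abs_nonneg _).trans_lt hx
  have hx2 : |x + x'| ≤ 2 := abs_le_of_sq_le_sq
    (by nlinarith [sq_nonneg (x - x'), sq_nonneg y, sq_nonneg y', sq_nonneg z, sq_nonneg z'])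
    zero_le_two
  have hy2 : |y + y'| ≤ 2 := abs_le_of_sq_le_sq
    (by nlinarith [sq_nonneg (y - y'), sq_nonneg x, sq_nonneg x', sq_nonneg z, sq_nonneg z'])
    zero_le_two
  have hz1 : 1 ≤ |z + z'| := by
    calc (1 : ℝ) ≤ |σ * (z + z')| := by rw [mul_add]; exact le_abs.2 (Or.inl (by linarith))
      _ = |z + z'| := by rw [abs_mul, hσ, one_mul]
  have hz2 : |z - z'| ≤ 4 * ε := by
    calc |z - z'| ≤ |z - z'| * |z + z'| := le_mul_of_one_le_right (abs_nonneg _) hz1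
      _ = |(x - x') * (x + x') + (y - y') * (y + y')| := by
        rw [← abs_mul, ← abs_neg]; congr 1; linear_combination h' - h
      _ ≤ |x - x'| * |x + x'| + |y - y'| * |y + y'| := by
        rw [← abs_mul, ← abs_mul]; exact abs_add_le _ _
      _ ≤ ε * 2 + ε * 2 := by gcongr
      _ = 4 * ε := by ring
  have e1 := sq_lt_sq' (by linarith [(abs_lt.1 hx).1]) (abs_lt.1 hx).2
  have e2 := sq_lt_sq' (by linarith [(abs_lt.1 hy).1]) (abs_lt.1 hy).2
  have e3 := sq_le_sq' (by linarith [(abs_le.1 hz2).1]) (abs_le.1 hz2).2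
  nlinarith

theorem summable_one_add_abs_int_rpow :
    Summable fun a : ℤ => (1 + |(a : ℝ)|) ^ (-(3 / 2) : ℝ) := by
  have h : Summable fun n : ℕ => (1 + (n : ℝ)) ^ (-(3 / 2) : ℝ) := by
    have := (summable_nat_add_iff 1).2 (Real.summable_nat_rpow (p := (-(3 / 2) : ℝ)) |>.2 (by norm_num))
    refine this.congr fun n => ?_
    push_cast
    rw [add_comm]
  apply Summable.of_nat_of_neg
  · simpa using h
  · simpa using h

/-- The sum of `(1 + q ‖s - p‖)⁻³` over points `p` that are `5 c / q` apart and lie in one of the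
six patches of the sphere. -/
theorem sum_inv_one_add_pow_three_patch_le {ι : Type*} (F : Finset ι)
    (p : ι → EuclideanSpace ℝ (Fin 3)) (s : EuclideanSpace ℝ (Fin 3)) {l m n : Fin 3}
    (hlmn : ∀ x : EuclideanSpace ℝ (Fin 3), ‖x‖ ^ 2 = x l ^ 2 + x m ^ 2 + x n ^ 2)
    {σ q c : ℝ} (hσ : |σ| = 1) (hq : 0 < q) (hc : 0 < c) (hc1 : c ≤ 1)
    (hp : ∀ k ∈ F, ‖p k‖ = 1) (hσp : ∀ k ∈ F, 1 / 2 ≤ σ * p k n)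
    (hsep : ∀ k ∈ F, ∀ k' ∈ F, k ≠ k' → 5 * c ≤ q * ‖p k - p k'‖) :
    ∑ k ∈ F, ((1 + q * ‖s - p k‖) ^ 3)⁻¹ ≤
      ((c / 2) ^ (-(3 / 2) : ℝ)) ^ 2 * (∑' a : ℤ, (1 + |(a : ℝ)|) ^ (-(3 / 2) : ℝ)) ^ 2 := by
  set g : ℤ → ℝ := fun a => (1 + |(a : ℝ)|) ^ (-(3 / 2) : ℝ) with hg
  have hg0 : ∀ a, 0 ≤ g a := fun a => by positivity
  have hgs : Summable g := summable_one_add_abs_int_rpow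
  set ε := c / q with hεd
  have hε : 0 < ε := by positivity
  let cell : ι → ℤ × ℤ := fun k => (⌊(s l - p k l) / ε⌋, ⌊(s m - p k m) / ε⌋)
  have hfl : ∀ u v w : ℝ, ⌊(u - v) / ε⌋ = ⌊(u - w) / ε⌋ → |v - w| < ε := by
    intro u v w h
    have := Int.abs_sub_lt_one_of_floor_eq_floor h
    rw [← sub_div, abs_div, abs_of_pos hε, div_lt_one hε] at this
    rwa [sub_sub_sub_cancel_left, abs_sub_comm] at this
  -- Points in one cell of side ε = c/q have planar coordinates closer than ε, hence are less than
  -- 5ε apart on the patch, against the separation.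
  have hinj : Set.InjOn cell F := by
    intro k hk k' hk' h
    by_contra hne
    simp only [cell, Prod.mk.injEq] at h
    have h1 := hlmn (p k)
    have h2 := hlmn (p k')
    have h3 := hlmn (p k - p k')
    rw [hp k hk] at h1
    rw [hp k' hk'] at h2
    have h4 := sq_dist_lt_of_abs_lt (by linarith) (by linarith) hσ (hσp k hk) (hσp k' hk')
      (hfl _ _ _ h.1) (hfl _ _ _ h.2)
    have h5 := hsep k hk k' hk' hne
    have h6 : 5 * ε ≤ ‖p k - p k'‖ := by
      rw [hεd, ← mul_div_assoc, div_le_iff₀ hq]; linarith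
    simp only [PiLp.sub_apply] at h3
    nlinarith
  -- The exponent 3 is split evenly between the two coordinates; each half, 3/2 > 1, is summable
  -- over ℤ.
  have hcoord : ∀ (t : ℝ) (ρ : ℝ), |t| ≤ ρ → (1 + q * ρ) ^ (-(3 / 2) : ℝ) ≤
      (c / 2) ^ (-(3 / 2) : ℝ) * g ⌊t / ε⌋ := by
    intro t ρ ht
    have hρ : 0 ≤ ρ := (abs_nonneg _).trans ht
    rw [hg, ← Real.mul_rpow (by positivity) (by positivity)]
    apply Real.rpow_le_rpow_of_nonpos (by positivity) _ (by norm_num)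
    have h1 : |(⌊t / ε⌋ : ℝ)| ≤ |t / ε| + 1 := by
      have := Int.floor_le (t / ε)
      have := Int.lt_floor_add_one (t / ε)
      rw [abs_le]
      constructor <;> cases abs_cases (t / ε) <;> linarith
    have h2 : |t / ε| ≤ q * ρ / c := by
      rw [abs_div, abs_of_pos hε, hεd, div_div_eq_mul_div, mul_comm]
      gcongr
    have h3 : c / 2 * (1 + (q * ρ / c + 1)) = c + q * ρ / 2 := by field_simp; ring
    calc c / 2 * (1 + |(⌊t / ε⌋ : ℝ)|) ≤ c / 2 * (1 + (q * ρ / c + 1)) := by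
          gcongr; linarith
      _ = c + q * ρ / 2 := h3
      _ ≤ 1 + q * ρ := by nlinarith [mul_nonneg hq.le hρ]
  calc ∑ k ∈ F, ((1 + q * ‖s - p k‖) ^ 3)⁻¹
      ≤ ∑ k ∈ F, ((c / 2) ^ (-(3 / 2) : ℝ)) ^ 2 * (g (cell k).1 * g (cell k).2) := by
        apply Finset.sum_le_sum
        intro k _
        have h1 := hcoord (s l - p k l) _ (abs_apply_sub_le s (p k) l)
        have h2 := hcoord (s m - p k m) _ (abs_apply_sub_le s (p k) m)
        have h3 : ((1 + q * ‖s - p k‖) ^ 3)⁻¹ =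
            (1 + q * ‖s - p k‖) ^ (-(3 / 2) : ℝ) * (1 + q * ‖s - p k‖) ^ (-(3 / 2) : ℝ) := by
          rw [← Real.rpow_add (by positivity), ← Real.rpow_natCast, ← Real.rpow_neg (by positivity)]
          norm_num
        rw [h3]
        calc _ ≤ _ := mul_le_mul h1 h2 (by positivity) (by positivity)
          _ = _ := by ring
    _ = ((c / 2) ^ (-(3 / 2) : ℝ)) ^ 2 * ∑ v ∈ F.image cell, g v.1 * g v.2 := by
        rw [← Finset.mul_sum, Finset.sum_image hinj]
    _ ≤ ((c / 2) ^ (-(3 / 2) : ℝ)) ^ 2 * ∑' v : ℤ × ℤ, g v.1 * g v.2 := by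
        gcongr
        exact (hgs.mul_of_nonneg hgs hg0 hg0).sum_le_tsum _
          fun v _ => mul_nonneg (hg0 _) (hg0 _)
    _ = _ := by
        rw [sq (∑' a, g a), hgs.tsum_mul_tsum hgs (hgs.mul_of_nonneg hgs hg0 hg0)]

theorem exists_half_le_abs_apply {x : EuclideanSpace ℝ (Fin 3)} (hx : ‖x‖ = 1) :
    ∃ i, 1 / 2 ≤ |x i| := by
  by_contra! h
  have h1 := EuclideanSpace.real_norm_sq_eq x
  rw [hx, Fin.sum_univ_three] at h1
  have h2 : ∀ i, x i ^ 2 ≤ (1 / 2) ^ 2 := fun i => sq_le_sq' (by linarith [(abs_lt.1 (h i)).1])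
    (abs_lt.1 (h i)).2.le
  linarith [h2 0, h2 1, h2 2]

/-- Some coordinate of a unit vector has absolute value at least 1/2, so the six patches ±x_i ≥ 1/2
cover the sphere. Their overlaps only enlarge the bound. -/
theorem exists_sum_node_le (Q : QuadratureFamily) (hQ : Q.IsAdmissible) :
    ∃ C : ℝ, 0 ≤ C ∧ ∀ j (s : S2), ∑ k : Fin (Q.n j),
      ((1 + 2 ^ j * ‖(s : EuclideanSpace ℝ (Fin 3)) - Q.node j k‖) ^ 3)⁻¹ ≤ C := by
  obtain ⟨c₀, hc₀, hsep⟩ := exists_le_norm_node_sub Q hQ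
  set c := min 1 (c₀ / 5) with hcd
  have hc : 0 < c := by positivity
  have hc1 : c ≤ 1 := min_le_left _ _
  have hc5 : 5 * c ≤ c₀ := by linarith [min_le_right 1 (c₀ / 5)]
  set G := ((c / 2) ^ (-(3 / 2) : ℝ)) ^ 2 * (∑' a : ℤ, (1 + |(a : ℝ)|) ^ (-(3 / 2) : ℝ)) ^ 2
    with hG
  refine ⟨∑ _v : Fin 3 × Bool, G, by positivity, fun j s => ?_⟩
  let sgn : Bool → ℝ := fun b => if b then 1 else -1
  let f : Fin (Q.n j) → ℝ := fun k =>
    ((1 + 2 ^ j * ‖(s : EuclideanSpace ℝ (Fin 3)) - Q.node j k‖) ^ 3)⁻¹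
  have hf : ∀ k, 0 ≤ f k := fun k => by positivity
  let P : Fin 3 × Bool → Fin (Q.n j) → Prop := fun v k =>
    1 / 2 ≤ sgn v.2 * (Q.node j k : EuclideanSpace ℝ (Fin 3)) v.1
  classical
  have hcover : ∀ k, ∃ v, P v k := by
    intro k
    obtain ⟨i, hi⟩ := exists_half_le_abs_apply (norm_S2 (Q.node j k))
    rcases le_abs.1 hi with h | h
    · exact ⟨(i, true), by simpa [P, sgn] using h⟩
    · exact ⟨(i, false), by simpa [P, sgn] using h⟩
  calc ∑ k, f k ≤ ∑ k, ∑ v, (if P v k then f k else 0) := by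
        apply Finset.sum_le_sum
        intro k _
        obtain ⟨v, hv⟩ := hcover k
        refine le_trans (le_of_eq (if_pos hv).symm)
          (Finset.single_le_sum (f := fun v => if P v k then f k else 0) ?_ (Finset.mem_univ v))
        intro w _
        split_ifs
        · exact hf k
        · exact le_rfl
    _ = ∑ v, ∑ k with P v k, f k := by
        rw [Finset.sum_comm]
        simp_rw [Finset.sum_filter]
    _ ≤ ∑ _v : Fin 3 × Bool, G := by
        apply Finset.sum_le_sum
        rintro ⟨i, b⟩ _
        have hσ : |sgn b| = 1 := by cases b <;> simp [sgn]
        have hlmn : ∀ x : EuclideanSpace ℝ (Fin 3),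
            ‖x‖ ^ 2 = x (i + 1) ^ 2 + x (i + 2) ^ 2 + x i ^ 2 := by
          intro x
          rw [EuclideanSpace.real_norm_sq_eq, Fin.sum_univ_three]
          fin_cases i <;> simp <;> ring
        refine sum_inv_one_add_pow_three_patch_le _
          (fun k => (Q.node j k : EuclideanSpace ℝ (Fin 3))) s hlmn hσ (by positivity) hc hc1
          (fun k _ => norm_S2 _) (fun k hk => (Finset.mem_filter.1 hk).2)
          (fun k _ k' _ hkk => hc5.trans (hsep j k k' hkk))

end Geometry

end Needlet

namespace Needlet

/-! ### Finite differences of the coefficients. -/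

section Differences

open Filter Topology

theorem abs_fwdDiff_iter_le {i : ℕ} : ∀ {f : ℝ → ℝ} {M h : ℝ}, ContDiff ℝ i f →
    (∀ x, |iteratedDeriv i f x| ≤ M) → 0 ≤ h → ∀ x, |(fwdDiff h)^[i] f x| ≤ M * h ^ i := by
  induction i with
  | zero => intro f M h _ hM _ x; simpa using hM x
  | succ i ih =>
    intro f M h hf hM hh x
    have hfi : ContDiff ℝ i f := hf.of_le (by exact_mod_cast i.le_succ)
    have hfs : ContDiff ℝ i (fun y => f (y + h)) := hfi.comp (by fun_prop)
    have hdiff : Differentiable ℝ (iteratedDeriv i f) :=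
      hf.differentiable_iteratedDeriv i (by exact_mod_cast i.lt_succ_self)
    have h1 : ∀ y, |iteratedDeriv i (fwdDiff h f) y| ≤ M * h := by
      intro y
      have e : iteratedDeriv i (fwdDiff h f) y = iteratedDeriv i f (y + h) - iteratedDeriv i f y := by
        have : fwdDiff h f = fun y => f (y + h) - f y := rfl
        rw [this, iteratedDeriv_fun_sub hfs.contDiffAt hfi.contDiffAt, iteratedDeriv_comp_add_const]
      have := Convex.norm_image_sub_le_of_norm_deriv_le (f := iteratedDeriv i f) (C := M)
        (s := Set.univ) (x := y) (y := y + h) (fun z _ => hdiff z)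
        (fun z _ => by rw [← iteratedDeriv_succ]; exact hM z) convex_univ trivial trivial
      rw [e]
      simpa [abs_of_nonneg hh] using this
    have h2 := ih (f := fwdDiff h f) (M := M * h) (h := h) (hfs.sub hfi) h1 hh x
    rw [Function.iterate_succ_apply]
    refine h2.trans (le_of_eq ?_)
    ring

theorem fwdDiff_iter_comp_affine (f : ℝ → ℝ) (x h : ℝ) (i : ℕ) :
    ∀ m : ℕ, (fwdDiff 1)^[i] (fun n : ℕ => f (x + n * h)) m = (fwdDiff h)^[i] f (x + m * h) := by
  induction i with
  | zero => intro m; rfl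
  | succ i ih =>
    intro m
    rw [Function.iterate_succ_apply', Function.iterate_succ_apply', fwdDiff, fwdDiff, ih, ih]
    push_cast
    ring_nf

/-- The values b_j(n) sample κ along a progression of step 2/2^j, so an i-th difference is bounded
by sup |κ^(i)| times the i-th power of the step. -/
theorem exists_abs_fwdDiff_levelCutoff_le {r : ℕ} {κ : ℝ → ℝ} (hκ : IsCutoff r κ) :
    ∃ V : ℝ, 0 ≤ V ∧ ∀ i ≤ 3, ∀ j m : ℕ,
      |(fwdDiff 1)^[i] (fun n : ℕ => levelCutoff κ j n) m| ≤ V / (2 ^ j) ^ i := by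
  have hcs : HasCompactSupport κ := by
    rw [HasCompactSupport, hκ.tsupport_eq]; exact isCompact_Icc
  have hb : ∀ i : ℕ, i ≤ 3 → ∃ M, ∀ x, |iteratedDeriv i κ x| ≤ M := by
    intro i hi
    have hir : (i : WithTop ℕ∞) ≤ r := by exact_mod_cast hi.trans hκ.two_lt
    obtain ⟨M, hM⟩ := (hcs.iteratedFDeriv (𝕜 := ℝ) i).exists_bound_of_continuous
      (hκ.contDiff.continuous_iteratedFDeriv hir)
    exact ⟨M, fun x => by simpa [norm_iteratedFDeriv_eq_norm_iteratedDeriv] using hM x⟩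
  have hb' : ∀ i : ℕ, ∃ M, i ≤ 3 → ∀ x, |iteratedDeriv i κ x| ≤ M := by
    intro i
    by_cases hi : i ≤ 3
    · obtain ⟨M, hM⟩ := hb i hi
      exact ⟨M, fun _ => hM⟩
    · exact ⟨0, fun h => absurd h hi⟩
  choose M hM using hb'
  have hM0 : ∀ i ≤ 3, 0 ≤ M i := fun i hi => (abs_nonneg _).trans (hM i hi 0)
  refine ⟨∑ i ∈ Finset.range 4, M i * 2 ^ i, Finset.sum_nonneg fun i hi => ?_,
    fun i hi j m => ?_⟩
  · have := hM0 i (by simp at hi; omega)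
    positivity
  · have e : (fun n : ℕ => levelCutoff κ j n) =
        fun n : ℕ => κ (((2 : ℝ) ^ j)⁻¹ + n * (2 / 2 ^ j)) := by
      funext n
      rw [levelCutoff]
      congr 1
      ring
    rw [e, fwdDiff_iter_comp_affine]
    have hir : (i : WithTop ℕ∞) ≤ r := by exact_mod_cast hi.trans hκ.two_lt
    refine (abs_fwdDiff_iter_le (hκ.contDiff.of_le hir) (hM i hi) (by positivity) _).trans ?_
    rw [div_pow, ← mul_div_assoc]
    gcongr
    refine Finset.single_le_sum (f := fun i => M i * 2 ^ i) (fun k hk => ?_)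
      (Finset.mem_range.2 (by omega))
    have := hM0 k (by simp at hk; omega)
    positivity

theorem levelCutoff_eq_zero_of_lt {r : ℕ} {κ : ℝ → ℝ} (hκ : IsCutoff r κ) {j m : ℕ}
    (h : (4 * m + 2 : ℝ) < 2 ^ j) : levelCutoff κ j m = 0 := by
  refine image_eq_zero_of_notMem_tsupport (f := κ) ?_
  rw [hκ.tsupport_eq]
  intro hmem
  have h1 := hmem.1
  rw [inv_mul_eq_div, div_le_div_iff₀ (by norm_num) (by positivity)] at h1
  linarith

theorem levelCutoff_eq_zero_of_le {r : ℕ} {κ : ℝ → ℝ} (hκ : IsCutoff r κ) {j m : ℕ}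
    (h : 2 ^ j ≤ m) : levelCutoff κ j m = 0 := by
  refine image_eq_zero_of_notMem_tsupport (f := κ) ?_
  rw [hκ.tsupport_eq]
  intro hmem
  have h1 := hmem.2
  have h2 : (2 : ℝ) ^ j ≤ m := by exact_mod_cast h
  rw [inv_mul_eq_div, div_le_iff₀ (by positivity)] at h1
  linarith

/-- A discrete form of t^(-p-1) = -(t^(-p))'/p, which makes tail sums telescope. It follows from
log(1 + 1/t) ≥ 1/(t+1) and e^y ≥ 1 + y; the constant absorbs t + 1 + p ≤ (2+p)t. -/
theorem rpow_neg_succ_le {t p : ℝ} (ht : 1 ≤ t) (hp : 0 < p) :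
    t ^ (-(p + 1)) ≤ (2 + p) / p * (t ^ (-p) - (t + 1) ^ (-p)) := by
  have ht0 : 0 < t := by linarith
  have h1 : 1 + p / (t + 1) ≤ ((t + 1) / t) ^ p := by
    have hl := Real.one_sub_inv_le_log_of_pos (x := (t + 1) / t) (by positivity)
    have hl' : 1 - ((t + 1) / t)⁻¹ = 1 / (t + 1) := by field_simp; ring
    rw [hl'] at hl
    have := Real.add_one_le_exp (Real.log ((t + 1) / t) * p)
    rw [← Real.rpow_def_of_pos (by positivity)] at this
    have h3 := mul_le_mul_of_nonneg_right hl hp.le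
    rw [one_div_mul_eq_div] at h3
    linarith
  rw [Real.div_rpow (by positivity) ht0.le, le_div_iff₀ (by positivity)] at h1
  rw [neg_add, Real.rpow_add ht0, Real.rpow_neg_one, Real.rpow_neg ht0.le,
    Real.rpow_neg (by positivity)]
  have hA : 0 < t ^ p := by positivity
  have hB : 0 < (t + 1) ^ p := by positivity
  have h4 : ((t + 1) ^ p)⁻¹ ≤ ((1 + p / (t + 1)) * t ^ p)⁻¹ := inv_anti₀ (by positivity) h1
  have h5 : (t ^ p)⁻¹ - ((1 + p / (t + 1)) * t ^ p)⁻¹ = (t ^ p)⁻¹ * (p / (t + 1 + p)) := by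
    field_simp; ring
  have h6 : t⁻¹ ≤ (2 + p) / p * (p / (t + 1 + p)) := by
    rw [div_mul_div_cancel₀ hp.ne', inv_eq_one_div, div_le_div_iff₀ ht0 (by positivity)]
    nlinarith
  calc (t ^ p)⁻¹ * t⁻¹ ≤ (t ^ p)⁻¹ * ((2 + p) / p * (p / (t + 1 + p))) := by gcongr
    _ = (2 + p) / p * ((t ^ p)⁻¹ - ((1 + p / (t + 1)) * t ^ p)⁻¹) := by rw [h5]; ring
    _ ≤ _ := by gcongr

/-- A null sequence is bounded by the tail sums of its differences. -/
theorem abs_le_of_abs_sub_le {g : ℕ → ℝ} (hg : Tendsto g atTop (𝓝 0)) {c p : ℝ} (hc : 0 ≤ c)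
    (hp : 0 < p) (h : ∀ m : ℕ, |g (m + 1) - g m| ≤ c * (1 + (m : ℝ)) ^ (-(p + 1))) (l : ℕ) :
    |g l| ≤ c * ((2 + p) / p) * (1 + (l : ℝ)) ^ (-p) := by
  have key : ∀ N : ℕ, |g l| ≤ |g (l + N)| + c * ((2 + p) / p) *
      ((1 + (l : ℝ)) ^ (-p) - (1 + ((l + N : ℕ) : ℝ)) ^ (-p)) := by
    intro N
    induction N with
    | zero => simp
    | succ N ih =>
      have h1 := h (l + N)
      have h2 := rpow_neg_succ_le (t := 1 + ((l + N : ℕ) : ℝ)) (by simp; positivity) hp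
      have h3 := mul_le_mul_of_nonneg_left h2 hc
      have h4 : |g (l + N)| ≤ |g (l + N + 1)| + |g (l + N + 1) - g (l + N)| := by
        have := abs_sub (g (l + N + 1)) (g (l + N + 1) - g (l + N))
        rwa [sub_sub_cancel] at this
      have e : (1 + ((l + (N + 1) : ℕ) : ℝ)) = 1 + ((l + N : ℕ) : ℝ) + 1 := by push_cast; ring
      rw [e, ← add_assoc]
      rw [← mul_assoc] at h3
      linarith
  have hlim : Tendsto (fun N : ℕ => |g (l + N)| + c * ((2 + p) / p) * (1 + (l : ℝ)) ^ (-p)) atTop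
      (𝓝 (|0| + c * ((2 + p) / p) * (1 + (l : ℝ)) ^ (-p))) :=
    ((hg.comp (tendsto_add_atTop_nat l |>.congr fun N => add_comm _ _)).abs).add_const _
  rw [abs_zero, zero_add] at hlim
  refine ge_of_tendsto' hlim fun N => (key N).trans ?_
  gcongr
  have : (0 : ℝ) ≤ (1 + ((l + N : ℕ) : ℝ)) ^ (-p) := by positivity
  linarith

theorem tendsto_fwdDiff_iter {u : ℕ → ℝ} (hu : Tendsto u atTop (𝓝 0)) (i : ℕ) :
    Tendsto ((fwdDiff 1)^[i] u) atTop (𝓝 0) := by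
  induction i with
  | zero => exact hu
  | succ i ih =>
    rw [Function.iterate_succ_apply']
    have := ((tendsto_add_atTop_iff_nat 1).2 ih).sub ih
    rwa [sub_zero] at this

/-- Descending induction on the order: every difference of a null sequence is null, hence is minus
the tail sum of the next one, which lowers the decay exponent by one. -/
theorem exists_abs_fwdDiff_iter_le {u : ℕ → ℝ} (hu : Tendsto u atTop (𝓝 0)) {γ : ℝ} (hγ : 0 < γ)
    {r : ℕ} (hr : ∃ c : ℝ, 0 ≤ c ∧
      ∀ l : ℕ, |(fwdDiff 1)^[r] u l| ≤ c * (1 + (l : ℝ)) ^ (-(γ + r))) {i : ℕ} (hi : i ≤ r) :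
    ∃ c : ℝ, 0 ≤ c ∧ ∀ l : ℕ, |(fwdDiff 1)^[i] u l| ≤ c * (1 + (l : ℝ)) ^ (-(γ + i)) := by
  refine Nat.decreasingInduction (motive := fun i _ => ∃ c : ℝ, 0 ≤ c ∧
    ∀ l : ℕ, |(fwdDiff 1)^[i] u l| ≤ c * (1 + (l : ℝ)) ^ (-(γ + i))) ?_ hr hi
  rintro k _ ⟨c, hc, h⟩
  have hp : 0 < γ + k := by positivity
  refine ⟨c * ((2 + (γ + k)) / (γ + k)), by positivity, fun l => ?_⟩
  refine abs_le_of_abs_sub_le (tendsto_fwdDiff_iter hu k) hc hp (fun m => ?_) l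
  have := h m
  rw [Function.iterate_succ_apply', fwdDiff] at this
  push_cast at this
  rwa [add_assoc]

theorem fwdDiff_iter_two_apply (f : ℕ → ℝ) (m : ℕ) :
    (fwdDiff 1)^[2] f m = f (m + 2) - 2 * f (m + 1) + f m := by
  simp [fwdDiff, add_assoc]
  ring

theorem fwdDiff_iter_three_apply (f : ℕ → ℝ) (m : ℕ) :
    (fwdDiff 1)^[3] f m = f (m + 3) - 3 * f (m + 2) + 3 * f (m + 1) - f m := by
  simp [fwdDiff, add_assoc]
  ring

/-- The sequence `a` lives at scale `q`: its differences of order at most three gain a factor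
`q⁻¹` each, and it vanishes at indices that are small compared to `q`. -/
structure IsScaled (a : ℕ → ℝ) (q W : ℝ) : Prop where
  zero : ∀ m : ℕ, |a m| ≤ W
  one : ∀ m : ℕ, |a (m + 1) - a m| ≤ W / q
  two : ∀ m : ℕ, |a (m + 2) - 2 * a (m + 1) + a m| ≤ W / q ^ 2
  three : ∀ m : ℕ, |a (m + 3) - 3 * a (m + 2) + 3 * a (m + 1) - a m| ≤ W / q ^ 3
  eq_zero : ∀ m : ℕ, 4 * (m : ℝ) + 2 < q → a m = 0

/-- Discrete Leibniz rule; 8 = 2³ is the sum of the binomial coefficients at order three. Bounds on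
u are needed only where b can be nonzero. -/
theorem isScaled_mul {b u : ℕ → ℝ} {q U V : ℝ} (hq : 0 < q) (hU : 0 ≤ U) (hV : 0 ≤ V)
    (hb : ∀ i ≤ 3, ∀ m : ℕ, |(fwdDiff 1)^[i] b m| ≤ V / q ^ i)
    (hu : ∀ i ≤ 3, ∀ m : ℕ, q ≤ 16 * ((m : ℝ) + 1) → |(fwdDiff 1)^[i] u m| ≤ U / q ^ i)
    (hb0 : ∀ m : ℕ, 4 * (m : ℝ) + 2 < q → b m = 0) :
    IsScaled (fun m => b m * u m) q (8 * (U * V)) := by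
  -- The threshold 16 is generous enough that b vanishes at all four points m, …, m+3 of a third
  -- difference.
  have hz : ∀ m : ℕ, ¬ q ≤ 16 * ((m : ℝ) + 1) →
      b m = 0 ∧ b (m + 1) = 0 ∧ b (m + 2) = 0 ∧ b (m + 3) = 0 := by
    intro m hm
    have hm0 : (0 : ℝ) ≤ m := by positivity
    push Not at hm
    refine ⟨hb0 _ ?_, hb0 _ ?_, hb0 _ ?_, hb0 _ ?_⟩ <;> push_cast <;> linarith
  have hs : ∀ (m k : ℕ), q ≤ 16 * ((m : ℝ) + 1) → q ≤ 16 * (((m + k : ℕ) : ℝ) + 1) := by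
    intro m k hm
    have : (0 : ℝ) ≤ k := by positivity
    push_cast
    linarith
  have hmul : ∀ i ≤ 3, ∀ k ≤ 3, ∀ m n : ℕ, q ≤ 16 * ((n : ℝ) + 1) →
      |(fwdDiff 1)^[i] b m * (fwdDiff 1)^[k] u n| ≤ U * V / q ^ (i + k) := by
    intro i hi k hk m n hn
    rw [abs_mul, pow_add, mul_comm U V, ← div_mul_div_comm]
    exact mul_le_mul (hb i hi m) (hu k hk n hn) (abs_nonneg _) (by positivity)
  have hUV : 0 ≤ U * V := by positivity
  refine ⟨fun m => ?_, fun m => ?_, fun m => ?_, fun m => ?_, fun m hm => by simp [hb0 m hm]⟩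
  · by_cases hm : q ≤ 16 * ((m : ℝ) + 1)
    · have := hmul 0 (by norm_num) 0 (by norm_num) m m hm
      simp at this ⊢
      linarith
    · simp [(hz m hm).1]; positivity
  · by_cases hm : q ≤ 16 * ((m : ℝ) + 1)
    · have h1 := hmul 0 (by norm_num) 1 (by norm_num) m m hm
      have h2 := hmul 1 (by norm_num) 0 (by norm_num) m (m + 1) (hs m 1 hm)
      simp only [Function.iterate_zero, id, Function.iterate_one, fwdDiff, zero_add, add_zero,
        pow_one] at h1 h2
      have e : b (m + 1) * u (m + 1) - b m * u m =
        b m * (u (m + 1) - u m) + (b (m + 1) - b m) * u (m + 1) := by ring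
      rw [e]
      refine (abs_add_le _ _).trans ?_
      have h3 : 8 * (U * V) / q = 8 * (U * V / q) := by ring
      have h4 : 0 ≤ U * V / q := by positivity
      linarith
    · obtain ⟨h0, h1, -, -⟩ := hz m hm
      simp [h0, h1]; positivity
  · by_cases hm : q ≤ 16 * ((m : ℝ) + 1)
    · have h1 := hmul 0 (by norm_num) 2 (by norm_num) m m hm
      have h2 := hmul 1 (by norm_num) 1 (by norm_num) m (m + 1) (hs m 1 hm)
      have h3 := hmul 2 (by norm_num) 0 (by norm_num) m (m + 2) (hs m 2 hm)
      simp only [fwdDiff_iter_two_apply] at h1 h3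
      simp only [Function.iterate_zero, id, Function.iterate_one, fwdDiff, zero_add, add_zero,
        Nat.reduceAdd, add_assoc] at h1 h2 h3
      have e : b (m + 2) * u (m + 2) - 2 * (b (m + 1) * u (m + 1)) + b m * u m =
        b m * (u (m + 2) - 2 * u (m + 1) + u m) +
        2 * ((b (m + 1) - b m) * (u (m + 2) - u (m + 1))) +
        (b (m + 2) - 2 * b (m + 1) + b m) * u (m + 2) := by ring
      rw [e]
      refine (abs_add_three _ _ _).trans ?_
      rw [abs_mul (2 : ℝ), abs_two]
      have h5 : 8 * (U * V) / q ^ 2 = 8 * (U * V / q ^ 2) := by ring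
      have h4 : 0 ≤ U * V / q ^ 2 := by positivity
      linarith
    · obtain ⟨h0, h1, h2, -⟩ := hz m hm
      simp [h0, h1, h2]; positivity
  · by_cases hm : q ≤ 16 * ((m : ℝ) + 1)
    · have h1 := hmul 0 (by norm_num) 3 (by norm_num) m m hm
      have h2 := hmul 1 (by norm_num) 2 (by norm_num) m (m + 1) (hs m 1 hm)
      have h3 := hmul 2 (by norm_num) 1 (by norm_num) m (m + 2) (hs m 2 hm)
      have h4 := hmul 3 (by norm_num) 0 (by norm_num) m (m + 3) (hs m 3 hm)
      simp only [fwdDiff_iter_two_apply, fwdDiff_iter_three_apply] at h1 h2 h3 h4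
      simp only [Function.iterate_zero, id, Function.iterate_one, fwdDiff, zero_add, add_zero,
        Nat.reduceAdd, add_assoc] at h1 h2 h3 h4
      have e : b (m + 3) * u (m + 3) - 3 * (b (m + 2) * u (m + 2)) +
          3 * (b (m + 1) * u (m + 1)) - b m * u m =
        b m * (u (m + 3) - 3 * u (m + 2) + (3 * u (m + 1)) - u m) +
        3 * ((b (m + 1) - b m) * (u (m + 3) - 2 * u (m + 2) + u (m + 1))) +
        3 * ((b (m + 2) - 2 * b (m + 1) + b m) * (u (m + 3) - u (m + 2))) +
        (b (m + 3) - 3 * b (m + 2) + 3 * b (m + 1) - b m) * u (m + 3) := by ring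
      rw [e]
      refine (abs_add_le _ _).trans ((add_le_add_left (abs_add_three _ _ _) _).trans ?_)
      rw [abs_mul (3 : ℝ), abs_mul (3 : ℝ), abs_of_pos (three_pos : (0 : ℝ) < 3)]
      have h5 : 8 * (U * V) / q ^ 3 = 8 * (U * V / q ^ 3) := by ring
      linarith
    · obtain ⟨h0, h1, h2, h3⟩ := hz m hm
      simp [h0, h1, h2, h3]; positivity

end Differences

end Needlet

namespace Needlet

/-! ### Localisation of the zonal kernel. -/

section Kernel

open Finset

theorem IsScaled.nonneg {a : ℕ → ℝ} {q W : ℝ} (h : IsScaled a q W) : 0 ≤ W :=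
  (abs_nonneg _).trans (h.zero 0)

theorem legendreShift_zero (a : ℕ → ℝ) : legendreShift a 0 = a 0 - a 1 := by
  simp [legendreShift]

/-- Displays the shift as a second difference plus a first difference divided by 2n + 3. Since n is
of order at least q where a is nonzero, both parts are O(q⁻²). -/
theorem legendreShift_succ (a : ℕ → ℝ) (n : ℕ) :
    legendreShift a (n + 1) = -(((n : ℝ) + 1) / (2 * n + 3) * (a (n + 2) - 2 * a (n + 1) + a n)) -
      1 / (2 * n + 3) * (a (n + 2) - a (n + 1)) := by
  have h : (2 * (n : ℝ) + 3) ≠ 0 := by positivity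
  have h' : (2 * (((n : ℝ) + 1)) + 1) ≠ 0 := by positivity
  rw [legendreShift]
  push_cast
  field_simp
  ring

theorem legendreShift_sub_succ (a : ℕ → ℝ) (n : ℕ) :
    legendreShift a (n + 1) - legendreShift a (n + 2) =
      ((n : ℝ) + 1) / (2 * n + 3) * (a (n + 3) - 3 * a (n + 2) + 3 * a (n + 1) - a n) +
      (1 / (2 * n + 3) * (1 / (2 * n + 5)) + 1 / (2 * n + 5)) *
        (a (n + 3) - 2 * a (n + 2) + a (n + 1)) -
      2 * (1 / (2 * n + 3) * (1 / (2 * n + 5))) * (a (n + 2) - a (n + 1)) := by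
  have h : (2 * (n : ℝ) + 3) ≠ 0 := by positivity
  have h' : (2 * (((n : ℝ) + 1)) + 3) ≠ 0 := by positivity
  have h'' : (2 * (n : ℝ) + 5) ≠ 0 := by positivity
  rw [legendreShift_succ, legendreShift_succ a (n + 1)]
  push_cast
  simp only [add_assoc, Nat.reduceAdd]
  field_simp
  ring

theorem IsScaled.eq_zero_of_lt {a : ℕ → ℝ} {q W : ℝ} (h : IsScaled a q W) {n : ℕ}
    (hn : 16 * ((n : ℝ) + 1) < q) :
    a n = 0 ∧ a (n + 1) = 0 ∧ a (n + 2) = 0 ∧ a (n + 3) = 0 := by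
  have hn0 : (0 : ℝ) ≤ n := by positivity
  refine ⟨h.eq_zero _ ?_, h.eq_zero _ ?_, h.eq_zero _ ?_, h.eq_zero _ ?_⟩ <;> push_cast <;> linarith

theorem IsScaled.abs_legendreShift_le {a : ℕ → ℝ} {q W : ℝ} (h : IsScaled a q W) (hq : 0 < q)
    (l : ℕ) : |legendreShift a l| ≤ 16 * W / q ^ 2 := by
  have hW := h.nonneg
  cases l with
  | zero =>
    rw [legendreShift_zero]
    by_cases hq16 : 16 * (((0 : ℕ) : ℝ) + 1) < q
    · obtain ⟨h0, h1, -, -⟩ := h.eq_zero_of_lt hq16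
      simp only [zero_add] at h1
      simp [h0, h1]; positivity
    -- At l = 0 only a first difference is available, but here q ≤ 16, so W/q ≤ 16W/q².
    · have h1 := h.one 0
      rw [abs_sub_comm, zero_add] at h1
      refine h1.trans ?_
      rw [div_le_div_iff₀ hq (by positivity)]
      simp at hq16
      nlinarith [mul_le_mul_of_nonneg_left hq16 (mul_nonneg hW hq.le)]
  | succ n =>
    rw [legendreShift_succ]
    by_cases hqn : 16 * ((n : ℝ) + 1) < q
    · obtain ⟨h0, h1, h2, -⟩ := h.eq_zero_of_lt hqn
      simp [h0, h1, h2]; positivity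
    · have h1 := h.one (n + 1)
      have h2 := h.two n
      have e1 : ((n : ℝ) + 1) / (2 * n + 3) ≤ 1 := by
        rw [div_le_one (by positivity)]; linarith [(Nat.cast_nonneg n : (0 : ℝ) ≤ n)]
      have e2 : 1 / (2 * (n : ℝ) + 3) ≤ 8 / q := by
        rw [div_le_div_iff₀ (by positivity) hq]; linarith
      calc _ ≤ _ := abs_sub _ _
        _ = ((n : ℝ) + 1) / (2 * n + 3) * |a (n + 2) - 2 * a (n + 1) + a n| +
            1 / (2 * n + 3) * |a (n + 2) - a (n + 1)| := by
          rw [abs_neg, abs_mul, abs_mul, abs_of_nonneg (by positivity),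
            abs_of_nonneg (by positivity : 0 ≤ 1 / (2 * (n : ℝ) + 3))]
        _ ≤ 1 * (W / q ^ 2) + 8 / q * (W / q) := by gcongr
        _ = 9 * W / q ^ 2 := by field_simp; ring
        _ ≤ _ := by gcongr; norm_num

theorem IsScaled.abs_legendreShift_sub_le {a : ℕ → ℝ} {q W : ℝ} (h : IsScaled a q W) (hq : 0 < q)
    (l : ℕ) : |legendreShift a l - legendreShift a (l + 1)| ≤ 512 * W / q ^ 3 := by
  have hW := h.nonneg
  cases l with
  | zero =>
    by_cases hq16 : 16 * (((0 : ℕ) : ℝ) + 1) < q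
    · rw [legendreShift_succ, legendreShift_zero]
      obtain ⟨h0, h1, h2, -⟩ := h.eq_zero_of_lt hq16
      simp only [zero_add] at h1 h2
      simp [h0, h1, h2]; positivity
    -- Again q ≤ 16, which turns 2 · 16W/q² into 512W/q³.
    · have h0 := h.abs_legendreShift_le hq 0
      have h1 := h.abs_legendreShift_le hq 1
      refine (abs_sub _ _).trans ((add_le_add h0 h1).trans ?_)
      simp at hq16
      rw [← add_div, div_le_div_iff₀ (by positivity) (by positivity)]
      nlinarith [mul_le_mul_of_nonneg_left hq16 (mul_nonneg hW (sq_nonneg q))]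
  | succ n =>
    rw [legendreShift_sub_succ]
    by_cases hqn : 16 * ((n : ℝ) + 1) < q
    · obtain ⟨h0, h1, h2, h3⟩ := h.eq_zero_of_lt hqn
      simp [h0, h1, h2, h3]; positivity
    · have h1 := h.one (n + 1)
      have h2 := h.two (n + 1)
      have h3 := h.three n
      have hn : (0 : ℝ) ≤ n := Nat.cast_nonneg n
      have e1 : ((n : ℝ) + 1) / (2 * n + 3) ≤ 1 := by
        rw [div_le_one (by positivity)]; linarith
      have e2 : 1 / (2 * (n : ℝ) + 3) ≤ 8 / q := by
        rw [div_le_div_iff₀ (by positivity) hq]; linarith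
      have e3 : 1 / (2 * (n : ℝ) + 5) ≤ 8 / q := by
        rw [div_le_div_iff₀ (by positivity) hq]; linarith
      have e4 : 1 / (2 * (n : ℝ) + 3) ≤ 1 := by
        rw [div_le_one (by positivity)]; linarith
      refine ((abs_sub _ _).trans (add_le_add_left (abs_add_le _ _) _)).trans ?_
      calc
        _ = ((n : ℝ) + 1) / (2 * n + 3) *
              |a (n + 3) - 3 * a (n + 2) + 3 * a (n + 1) - a n| +
            (1 / (2 * n + 3) * (1 / (2 * n + 5)) + 1 / (2 * n + 5)) *
              |a (n + 3) - 2 * a (n + 2) + a (n + 1)| +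
            2 * (1 / (2 * n + 3) * (1 / (2 * n + 5))) * |a (n + 2) - a (n + 1)| := by
          rw [abs_mul, abs_mul, abs_mul, abs_of_nonneg (by positivity),
            abs_of_nonneg (by positivity : 0 ≤ (1 / (2 * (n : ℝ) + 3) * (1 / (2 * n + 5)) +
              1 / (2 * n + 5))),
            abs_of_nonneg (by positivity : 0 ≤ 2 * (1 / (2 * (n : ℝ) + 3) * (1 / (2 * n + 5))))]
        _ ≤ 1 * (W / q ^ 3) + (1 * (8 / q) + 8 / q) * (W / q ^ 2) +
            2 * (8 / q * (8 / q)) * (W / q) := by gcongr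
        _ = 145 * W / q ^ 3 := by field_simp; ring
        _ ≤ _ := by gcongr; norm_num

/-- The localisation of zonal kernels, for coefficients at scale `q`. In terms of the Euclidean
distance `ρ` we have `1 - x = ρ ^ 2 / 2`. -/
theorem IsScaled.abs_sum_legendre_le {a : ℕ → ℝ} {q W : ℝ} (h : IsScaled a q W) {M : ℕ}
    (hM : (M : ℝ) + 1 ≤ 2 * q) (ha : ∀ l, M ≤ l → a l = 0) {x ρ : ℝ}
    (hx : x ∈ Set.Icc (-1 : ℝ) 1) (hρ : 0 ≤ ρ) (hxρ : ρ ^ 2 = 2 - 2 * x) :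
    |∑ l ∈ range (M + 1), (2 * (l : ℝ) + 1) * a l * (legendre l).eval x| ≤
      10 ^ 6 * W * (q ^ 2 * ((1 + q * ρ) ^ 3)⁻¹ + 1) := by
  have hW := h.nonneg
  have hq : 0 < q := by linarith [(Nat.cast_nonneg M : (0 : ℝ) ≤ M)]
  set S := ∑ l ∈ range (M + 1), (2 * (l : ℝ) + 1) * a l * (legendre l).eval x with hS
  have hS1 := one_sub_mul_sum_legendre a x M ha
  have hN : ((M + 1 : ℕ) : ℝ) ^ 2 ≤ 4 * q ^ 2 := by
    push_cast
    calc ((M : ℝ) + 1) ^ 2 ≤ (2 * q) ^ 2 := by gcongr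
      _ = 4 * q ^ 2 := by ring
  -- For x ≤ 0 the factor √(1-x²) degenerates at the antipode; there 1 - x ≥ 1 and second
  -- differences alone give O(W), the source of the summand 1 in the bound.
  rcases le_total x 0 with hx0 | hx0
  · have h1 := Needlet.abs_sum_legendre_le (legendreShift a) hx (M + 1)
      (h.abs_legendreShift_le hq)
    rw [← hS1, abs_mul, abs_of_nonneg (by linarith)] at h1
    have h2 : 2 * ((M + 1 : ℕ) : ℝ) ^ 2 * (16 * W / q ^ 2) ≤ 128 * W := by
      calc _ ≤ 2 * (4 * q ^ 2) * (16 * W / q ^ 2) := by gcongr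
        _ = 128 * W := by field_simp; ring
    have h3 : |S| ≤ (1 - x) * |S| := le_mul_of_one_le_left (abs_nonneg _) (by linarith)
    calc |S| ≤ 10 ^ 6 * W * 1 := by linarith
      _ ≤ _ := by gcongr; exact le_add_of_nonneg_left (by positivity)
  · have hnear := Needlet.abs_sum_legendre_le a hx (M + 1) h.zero
    have hd0 : legendreShift a (M + 1) = 0 := by
      rw [legendreShift, ha (M + 1) (by omega), ha (M + 1 + 1) (by omega), Nat.add_sub_cancel,
        ha M le_rfl]
      simp
    have hfar := abs_sum_derivative_legendre_le (legendreShift a) hx (M + 1)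
      (h.abs_legendreShift_sub_le hq)
    rw [← sum_legendre_eq_sum_derivative _ x (M + 1) hd0, ← hS1, abs_mul,
      abs_of_nonneg (by linarith [hx.2])] at hfar
    have h1 : |S| ≤ 8 * q ^ 2 * W := by
      refine hnear.trans ?_
      calc _ ≤ 2 * (4 * q ^ 2) * W := by gcongr
        _ = _ := by ring
    have h2 : 3 * ((M + 1 : ℕ) : ℝ) ^ 2 * (512 * W / q ^ 3) ≤ 6144 * W / q := by
      calc _ ≤ 3 * (4 * q ^ 2) * (512 * W / q ^ 3) := by gcongr
        _ = 6144 * W / q := by field_simp; ring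
    -- For x ≥ 0, 1 - x² ≥ 1 - x = ρ²/2.
    have hsq : ρ / 2 ≤ √(1 - x ^ 2) := by
      apply Real.le_sqrt_of_sq_le
      nlinarith [hx.2]
    have h3 : (q * ρ) ^ 3 * |S| ≤ 4 * 6144 * q ^ 2 * W := by
      have e : ρ ^ 3 * |S| ≤ 4 * (6144 * W / q) := by
        calc ρ ^ 3 * |S| = 4 * (ρ / 2 * ((ρ ^ 2 / 2) * |S|)) := by ring
          _ = 4 * (ρ / 2 * ((1 - x) * |S|)) := by rw [hxρ]; ring
          _ ≤ 4 * (√(1 - x ^ 2) * ((1 - x) * |S|)) := by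
            have : 0 ≤ (1 - x) * |S| := mul_nonneg (by linarith [hx.2]) (abs_nonneg _)
            gcongr
          _ ≤ 4 * (6144 * W / q) := by linarith
      calc (q * ρ) ^ 3 * |S| = q ^ 3 * (ρ ^ 3 * |S|) := by ring
        _ ≤ q ^ 3 * (4 * (6144 * W / q)) := by gcongr
        _ = _ := by field_simp
    -- Merges the near bound `h1` and the far bound `h3`; the resulting constant 4(8 + 4·6144) is
    -- below 10⁶.
    have h4 : (1 + q * ρ) ^ 3 ≤ 4 * (1 + (q * ρ) ^ 3) := by
      have : 0 ≤ q * ρ := by positivity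
      nlinarith [mul_nonneg (sq_nonneg (q * ρ - 1)) (by linarith : 0 ≤ q * ρ + 1)]
    have h5 : |S| ≤ 10 ^ 6 * W * (q ^ 2 * ((1 + q * ρ) ^ 3)⁻¹) := by
      rw [← mul_assoc, ← div_eq_mul_inv, le_div_iff₀ (by positivity)]
      have h6 := mul_le_mul_of_nonneg_left h4 (abs_nonneg S)
      have h7 : 0 ≤ q ^ 2 * W := by positivity
      linarith
    refine h5.trans ?_
    gcongr
    exact le_add_of_nonneg_right zero_le_one

end Kernel

/-! ### Scaling of the needlet coefficients and summation over the nodes. -/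

section Main

open Filter Topology Finset

theorem modifiedKernel_eq_sum {r : ℕ} {κ : ℝ → ℝ} (hκ : IsCutoff r κ) (A : ℕ → ℝ) (j : ℕ) (x : ℝ) :
    modifiedKernel κ A j x = (4 * Real.pi)⁻¹ * ∑ l ∈ range (2 ^ j + 1),
      (2 * (l : ℝ) + 1) * (levelCutoff κ j l * √(A l)) * (legendre l).eval x := by
  rw [modifiedKernel, tsum_eq_sum (s := range (2 ^ j + 1)), mul_sum]
  · refine sum_congr rfl fun l _ => ?_
    rw [div_eq_mul_inv]
    ring
  · intro l hl
    rw [levelCutoff_eq_zero_of_le hκ (by simp at hl; omega)]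
    simp

theorem tendsto_sqrt_of_summable {A : ℕ → ℝ} (hA : ∀ l, 0 ≤ A l)
    (hs : Summable fun l : ℕ => (2 * (l : ℝ) + 1) * A l) :
    Tendsto (fun l => √(A l)) atTop (𝓝 0) := by
  have h : Tendsto A atTop (𝓝 0) := by
    refine squeeze_zero hA (fun l => ?_) hs.tendsto_atTop_zero
    have := hA l
    nlinarith [mul_nonneg (Nat.cast_nonneg l : (0 : ℝ) ≤ l) this]
  simpa using h.sqrt

/-- Where the cutoff matters, 1 + m ≥ q/16, so decay in m of the differences of √A becomes decay in
q, at the price of powers of 16. -/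
theorem exists_isScaled {r : ℕ} {κ : ℝ → ℝ} (hκ : IsCutoff r κ) {A : ℕ → ℝ}
    (hA : ∀ l, 0 ≤ A l) (hs : Summable fun l : ℕ => (2 * (l : ℝ) + 1) * A l) {β c : ℝ}
    (hβ : 0 < β) (hc : 0 < c)
    (hdiff : ∀ l : ℕ, |(fwdDiff 1)^[r] (fun m : ℕ => √(A m)) l| ≤
      c * (1 + (l : ℝ)) ^ (-(1 + β + (r : ℝ)))) :
    ∃ W : ℝ, 0 ≤ W ∧ ∀ j : ℕ, IsScaled (fun l => levelCutoff κ j l * √(A l)) (2 ^ j)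
      (W * ((2 : ℝ) ^ j) ^ (-(1 + β))) := by
  have hγ : 0 < 1 + β := by linarith
  have hu := fun i (hi : i ≤ 3) => exists_abs_fwdDiff_iter_le (tendsto_sqrt_of_summable hA hs) hγ
    ⟨c, hc.le, hdiff⟩ (hi.trans hκ.two_lt)
  have hu' : ∀ i, ∃ d : ℝ, 0 ≤ d ∧ (i ≤ 3 → ∀ l : ℕ,
      |(fwdDiff 1)^[i] (fun m : ℕ => √(A m)) l| ≤ d * (1 + (l : ℝ)) ^ (-(1 + β + (i : ℝ)))) := by
    intro i
    by_cases hi : i ≤ 3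
    · obtain ⟨d, hd, h⟩ := hu i hi
      exact ⟨d, hd, fun _ => h⟩
    · exact ⟨0, le_rfl, fun h => absurd h hi⟩
  choose d hd0 hd using hu'
  obtain ⟨V, hV, hb⟩ := exists_abs_fwdDiff_levelCutoff_le hκ
  set U := ∑ i ∈ range 4, d i * 16 ^ (1 + β + (i : ℝ)) with hU
  have hU0 : 0 ≤ U := sum_nonneg fun i _ => mul_nonneg (hd0 i) (by positivity)
  refine ⟨8 * (U * V), by positivity, fun j => ?_⟩
  set q : ℝ := 2 ^ j with hqd
  have hq : 0 < q := by positivity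
  have hmain := isScaled_mul (b := fun n : ℕ => levelCutoff κ j n) (u := fun l => √(A l)) (q := q)
    (U := U * q ^ (-(1 + β))) hq (by positivity) hV (fun i hi m => hb i hi j m) ?_
    (fun m hm => levelCutoff_eq_zero_of_lt hκ hm)
  · convert hmain using 1
    ring
  · intro i hi m hm
    refine (hd i hi m).trans ?_
    have h1 : (1 + (m : ℝ)) ^ (-(1 + β + (i : ℝ))) ≤ (q / 16) ^ (-(1 + β + (i : ℝ))) :=
      Real.rpow_le_rpow_of_nonpos (by positivity) (by linarith)
        (by linarith [(Nat.cast_nonneg i : (0 : ℝ) ≤ i)])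
    have h2 : (q / 16) ^ (-(1 + β + (i : ℝ))) =
        16 ^ (1 + β + (i : ℝ)) * (q ^ (-(1 + β)) / q ^ i) := by
      rw [Real.div_rpow hq.le (by norm_num), Real.rpow_neg (by norm_num : (0 : ℝ) ≤ 16), div_inv_eq_mul,
        neg_add, Real.rpow_add hq, Real.rpow_neg hq.le (i : ℝ), Real.rpow_natCast]
      ring
    calc d i * (1 + (m : ℝ)) ^ (-(1 + β + (i : ℝ)))
        ≤ d i * (16 ^ (1 + β + (i : ℝ)) * (q ^ (-(1 + β)) / q ^ i)) := by
          rw [← h2]; exact mul_le_mul_of_nonneg_left h1 (hd0 i)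
      _ = d i * 16 ^ (1 + β + (i : ℝ)) * (q ^ (-(1 + β)) / q ^ i) := by ring
      _ ≤ U * (q ^ (-(1 + β)) / q ^ i) := by
          gcongr
          exact single_le_sum (f := fun i : ℕ => d i * 16 ^ (1 + β + (i : ℝ)))
            (fun k _ => mul_nonneg (hd0 k) (by positivity)) (mem_range.2 (by omega))
      _ = _ := by ring

theorem exists_sum_abs_modifiedNeedlet_le (Q : QuadratureFamily) (hQ : Q.IsAdmissible) {r : ℕ}
    {κ : ℝ → ℝ} (hκ : IsCutoff r κ) {A : ℕ → ℝ}
    (hA : ∀ l, 0 ≤ A l) (hs : Summable fun l : ℕ => (2 * (l : ℝ) + 1) * A l) {β c : ℝ}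
    (hβ : 0 < β) (hc : 0 < c)
    (hdiff : ∀ l : ℕ, |(fwdDiff 1)^[r] (fun m : ℕ => √(A m)) l| ≤
      c * (1 + (l : ℝ)) ^ (-(1 + β + (r : ℝ)))) :
    ∃ C : ℝ, 0 < C ∧ ∀ j (s : S2),
      ∑ k : Fin (Q.n j), |modifiedNeedlet κ A Q j k s| ≤ C * (2 : ℝ) ^ (-β * (j : ℝ)) := by
  obtain ⟨W, hW, hscaled⟩ := exists_isScaled hκ hA hs hβ hc hdiff
  obtain ⟨G, hG, hsum⟩ := exists_sum_node_le Q hQ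
  obtain ⟨C₀, hC₀, hcard⟩ := hQ.card_le
  obtain ⟨w, hw, hweight⟩ := hQ.weight_le
  -- The added 1 keeps the constant positive when W = 0.
  refine ⟨√w * (10 ^ 6 * W) * (G + C₀) + 1, by positivity, fun j s => ?_⟩
  set q : ℝ := 2 ^ j with hqd
  have hq : 0 < q := by positivity
  have hq1 : 1 ≤ q := one_le_pow₀ one_le_two
  have hq2 : (2 : ℝ) ^ (2 * j) = q ^ 2 := by rw [hqd, ← pow_mul, mul_comm]
  have hT : q * q ^ (-(1 + β)) = (2 : ℝ) ^ (-β * (j : ℝ)) := by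
    rw [← Real.rpow_one_add' hq.le (by linarith), hqd, ← Real.rpow_natCast, ← Real.rpow_mul (by norm_num)]
    congr 1
    ring
  set T := q ^ (-(1 + β)) with hTd
  have hT0 : 0 < T := by positivity
  have hM : (((2 ^ j : ℕ) : ℝ)) + 1 ≤ 2 * q := by push_cast; linarith
  have hterm : ∀ k : Fin (Q.n j), |modifiedNeedlet κ A Q j k s| ≤ √w / q * (10 ^ 6 * (W * T) *
      (q ^ 2 * ((1 + q * ‖(s : EuclideanSpace ℝ (Fin 3)) - Q.node j k‖) ^ 3)⁻¹ + 1)) := by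
    intro k
    have h1 := (hscaled j).abs_sum_legendre_le hM
      (fun l hl => by rw [levelCutoff_eq_zero_of_le hκ hl, zero_mul]) (dot_mem_Icc s (Q.node j k))
      (norm_nonneg _) (norm_sub_sq_eq_dot s (Q.node j k))
    have h2 : √(Q.weight j k) ≤ √w / q := by
      rw [← Real.sqrt_sq hq.le, ← Real.sqrt_div hw.le, div_eq_mul_inv, ← hq2]
      exact Real.sqrt_le_sqrt (hweight j k)
    have h3 : (4 * Real.pi)⁻¹ ≤ 1 := inv_le_one_of_one_le₀ (by linarith [Real.pi_gt_three])
    rw [modifiedNeedlet, abs_mul, abs_of_nonneg (Real.sqrt_nonneg _), modifiedKernel_eq_sum hκ,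
      abs_mul, abs_of_nonneg (by positivity : 0 ≤ (4 * Real.pi)⁻¹)]
    refine mul_le_mul h2 ?_ (by positivity) (by positivity)
    exact (mul_le_of_le_one_left (abs_nonneg _) h3).trans h1
  calc ∑ k : Fin (Q.n j), |modifiedNeedlet κ A Q j k s|
      ≤ ∑ k : Fin (Q.n j), √w / q * (10 ^ 6 * (W * T) *
        (q ^ 2 * ((1 + q * ‖(s : EuclideanSpace ℝ (Fin 3)) - Q.node j k‖) ^ 3)⁻¹ + 1)) :=
        sum_le_sum fun k _ => hterm k
    _ = √w / q * (10 ^ 6 * (W * T)) * (q ^ 2 * (∑ k : Fin (Q.n j),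
        ((1 + q * ‖(s : EuclideanSpace ℝ (Fin 3)) - Q.node j k‖) ^ 3)⁻¹) + Q.n j) := by
        simp_rw [← mul_assoc]
        rw [← mul_sum, sum_add_distrib, ← mul_sum]
        simp
    _ ≤ √w / q * (10 ^ 6 * (W * T)) * (q ^ 2 * G + C₀ * q ^ 2) := by
        have h1 := hsum j s
        have h2 := hcard j
        rw [hq2] at h2
        gcongr
    _ = √w * (10 ^ 6 * W) * (G + C₀) * (q * T) := by field_simp
    _ ≤ (√w * (10 ^ 6 * W) * (G + C₀) + 1) * (2 : ℝ) ^ (-β * (j : ℝ)) := by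
        rw [hT]
        gcongr
        linarith

end Main

end Needlet

theorem corollary6p1
    (Q : Needlet.QuadratureFamily) (hQ : Q.IsAdmissible)
    (r : ℕ) (κ : ℝ → ℝ) (hκ : Needlet.IsCutoff r κ)
    (A : ℕ → ℝ) (hA_nonneg : ∀ ℓ, 0 ≤ A ℓ)
    (hA_summable : Summable fun ℓ : ℕ => (2 * (ℓ : ℝ) + 1) * A ℓ)
    (β : ℝ) (hβ : 0 < β) (c_r : ℝ) (hc_r : 0 < c_r)
    (hA_diff : ∀ ℓ : ℕ,
      |(fwdDiff 1)^[r] (fun m : ℕ => √(A m)) ℓ| ≤ c_r * (1 + (ℓ : ℝ)) ^ (-(1 + β + (r : ℝ)))) :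
    ∃ C : ℝ, 0 < C ∧ ∀ j : ℕ,
      BddAbove (Set.range fun s : Needlet.S2 =>
        ∑ k : Fin (Q.n j), |Needlet.modifiedNeedlet κ A Q j k s|) ∧
      (⨆ s : Needlet.S2, ∑ k : Fin (Q.n j), |Needlet.modifiedNeedlet κ A Q j k s|) ≤
        C * (2 : ℝ) ^ (-β * (j : ℝ)) := by
  obtain ⟨C, hC, h⟩ := Needlet.exists_sum_abs_modifiedNeedlet_le Q hQ hκ hA_nonneg hA_summable
    hβ hc_r hA_diff
  refine ⟨C, hC, fun j => ⟨⟨C * (2 : ℝ) ^ (-β * (j : ℝ)), ?_⟩, ?_⟩⟩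
  · rintro _ ⟨s, rfl⟩
    exact h j s
  · exact Real.iSup_le (h j) (by positivity)
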